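/- Notation. For complex $a,q$ put $(a;q)_n=\prod_{k=0}^{n-1}(1-aq^k)$ and, for $|q|<1$, $(a;q)_\infty=\prod_{k\ge 0}(1-aq^k)$. Partitions are nonincreasing sequences $\lambda=(\lambda_1,\dots,\lambda_\ell)$ with length $\ell(\lambda)=\ell$ and size $|\lambda|=\sum_i\lambda_i$. $\mathcal P_\omega$ is the set of nonempty partitions whose smallest part (which may be $0$) occurs only once and all of whose odd parts are at most twice the smallest part plus $1$. $\mathcal P_\nu$ is the set of nonempty partitions into distinct parts (the smallest may be $0$) all of whose odd parts are less than twice the smallest part. $\mathcal P_\omega(m,n)$ and $\mathcal P_\nu(m,n)$ consist of the members of length $m+1$ and size $n$. The odd Ferrers graph $\mathcal F_\eta$ of a nonempty partition $\eta$ into positive parts is its Ferrers diagram with $0$ in the upper left box, $1$ in every other box of the first row or first column, and $2$ in every remaining box; its size $|\mathcal F_\eta|$ is the sum of these numbers. $\mathcal B^1_\omega(m,n)$ (respectively $\mathcal B^1_\nu(m,n)$) is the set of odd Ferrers graphs $\mathcal F_\eta$ of size $n$ with $m+1$ rows (respectively, of those for which $\eta$ has distinct parts). Operators. Let $\lambda=(\lambda_1,\dots,\lambda_\ell)$;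 a subscript $\ge$ means rearranging in nonincreasing order. Let $\phi^+(\lambda)=(\lambda_1,\dots,\lambda_{\ell-1},\lambda_\ell+1)_\ge$, $\phi^-(\lambda)=(\lambda_1,\dots,\lambda_{\ell-1},\lambda_\ell-1)$, $\phi^\pm_e(\lambda)=(\lambda_1\pm2,\dots,\lambda_\ell\pm2)$, $\phi^+_o(\lambda)=(\lambda_1+2,\dots,\lambda_{\ell-1}+2,\lambda_\ell+1)$, $\phi^-_o(\lambda)=(\lambda_1-2,\dots,\lambda_{\ell-1}-2,\lambda_\ell-1)_\ge$, $\phi^-_c(\lambda)=(\lambda_1,\dots,\lambda_{\ell-2},\lambda_{\ell-1}+\lambda_\ell)_\ge$; let $\phi^+_c(\lambda)$ be obtained from $\lambda$ by replacing one largest odd part $a$ by the two parts $(a+1)/2,(a-1)/2$ and rearranging; let $\lambda^-=(\lambda_1,\dots,\lambda_{\ell-1})$ and $\lambda^+=(\lambda_1,\dots,\lambda_\ell,0)$. * Destructive operator on $\lambda\in\mathcal P_\omega$, $\ell\ge2$: $\psi^-(\lambda)=\phi^-(\lambda^-)$ if $\lambda_\ell=0$ and $\lambda_{\ell-1}\ge2$;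 $\psi^-(\lambda)=\phi^-(\phi_c^-(\lambda))$ if $\lambda_{\ell-1}=\lambda_\ell+1$; $\psi^-(\lambda)=\phi^-_o(\lambda)$ if $\lambda_\ell\ge1$ and $\lambda_{\ell-1}\ge\lambda_\ell+2$. * Constructive operators on $\mathcal P_\omega$: $\psi_1^+(\lambda)=(\phi^+(\lambda))^+$ if $\lambda_\ell$ is odd and all other parts are even, $\psi^+_1(\lambda)=\phi^+_c(\phi^+(\lambda))$ otherwise; $\psi^+_2(\lambda)=\phi^+_o(\lambda)$. * Destructive operator on $\lambda\in\mathcal P_\nu$, $\ell\ge2$: $\rho^-(\lambda)=\phi^-_e(\lambda^-)$ if $\lambda_\ell=0$; $\rho^-(\lambda)=\phi^-_e(\phi^-_c(\lambda))$ if $\lambda_\ell\ge1$ and $\lambda_{\ell-1}=\lambda_\ell+1$; $\rho^-(\lambda)=\phi^-_o(\lambda)$ if $\lambda_\ell\ge1$ and $\lambda_{\ell-1}\ge\lambda_\ell+2$. * Constructive operators on $\mathcal P_\nu$: $\rho^+_1(\lambda)=(\phi^+_e(\lambda))^+$ if all parts are even, $\rho^+_1(\lambda)=\phi^+_c(\phi^+_e(\lambda))$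 otherwise; $\rho^+_2(\lambda)=\phi^+_o(\lambda)$. Maps. (i) For $\lambda\in\mathcal P_\omega$ let $\lambda^0=\lambda$ and $\lambda^i=\psi^-(\lambda^{i-1})$ until, for the first time, $\ell(\lambda^t)=1$; let $d_i=|\lambda^{i-1}|-|\lambda^i|$. Start with the one-row graph of shape $(|\lambda^t|+1)$ and, for $d=d_t,\dots,d_1$ in this order, add a new row of one box if $d=1$, and one box at the end of every row if $d\ne1$. The result is $\Phi_\omega(\lambda)$. (ii) For $\mathcal F_\eta$ repeat, until there is one row: delete the last box of every row if the last row has at least two boxes, otherwise delete the last row (a single box). Let $h_1,\dots,h_r$ be the successive decreases of the size and let $s$ be the size of the remaining one-row graph. Start with the partition $(s)$ and, for $h=h_r,\dots,h_1$, apply $\psi_1^+$ if $h=1$ and $\psi_2^+$ if $h\ne1$. The result is $\Psi_\omega(\mathcal F_\eta)$. (iii) $\Phi_\nu$ on $\mathcal P_\nu$ is defined as in (i) with $\rho^-$ instead of $\psi^-$, where for each $d$ one box is added at the end of every row and, if $d$ is even, also a new row of one box. (iv) $\Psi_\nu$ on odd Ferrers graphs with distinct rows is defined as in (ii), where each step deletes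 the last box of every row, and where $\rho^+_1$ is applied if $h$ is even and $\rho^+_2$ if $h$ is odd. Theorem 1.1. (a) Let $z,q\in\mathbb C$, $|q|<1$, and $zq^k\ne1$ for all $k\ge1$. Then $$\sum_{n\ge1}\frac{q^n}{(zq^n;q)_{n+1}(zq^{2n+2};q^2)_\infty}=\sum_{n\ge0}\frac{z^nq^{2n^2+2n+1}}{(q;q^2)_{n+1}(zq;q^2)_{n+1}}$$ and, in shifted form, $$\sum_{n\ge0}\frac{q^n}{(zq^{n+1};q)_{n+2}(zq^{2n+4};q^2)_\infty}=\sum_{n\ge0}\frac{z^nq^{2n^2+2n}}{(q;q^2)_{n+1}(zq;q^2)_{n+1}},$$ all four series being absolutely convergent. (b) For all $z,q\in\mathbb C$ with $|q|<1$, $$\sum_{n\ge0}q^n(-zq^{n+1};q)_n(-zq^{2n+2};q^2)_\infty=\sum_{n\ge0}\frac{z^nq^{n^2+n}}{(q;q^2)_{n+1}},$$ both series being absolutely convergent. (c) All the classes $\mathcal P_\omega(m,n)$, $\mathcal B^1_\omega(m,n)$, $\mathcal P_\nu(m,n)$, $\mathcal B^1_\nu(m,n)$ are finite. For $|q|<1$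 and $|zq|<1$, the left and the right side of the shifted identity in (a) equal $\sum_{m,n\ge0}|\mathcal P_\omega(m,n)|z^mq^n$ and $\sum_{m,n\ge0}|\mathcal B^1_\omega(m,n)|z^mq^n$, respectively. For $|q|<1$ and every $z$, the left and the right side of (b) equal $\sum_{m,n\ge0}|\mathcal P_\nu(m,n)|z^mq^n$ and $\sum_{m,n\ge0}|\mathcal B^1_\nu(m,n)|z^mq^n$, respectively. These double series converge absolutely. (d) The four procedures in (i)–(iv) always stop. For all $m,n\ge0$, $\Phi_\omega$ is a bijection from $\mathcal P_\omega(m,n)$ onto $\mathcal B^1_\omega(m,n)$ with inverse $\Psi_\omega$, and $\Phi_\nu$ is a bijection from $\mathcal P_\nu(m,n)$ onto $\mathcal B^1_\nu(m,n)$ with inverse $\Psi_\nu$. -/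

import Mathlib

namespace AndrewsYee

/-! ### q-Pochhammer symbols -/

/-- The finite symbol `(a;q)_n = (1 - a)(1 - aq)⋯(1 - aq^{n-1})`. -/
noncomputable def qPoch (a q : ℂ) (n : ℕ) : ℂ :=
  ∏ k ∈ Finset.range n, (1 - a * q ^ k)

/-- The infinite symbol `(a;q)_∞`, used only for `‖q‖ < 1`. -/
noncomputable def qPochInf (a q : ℂ) : ℂ :=
  ∏' k : ℕ, (1 - a * q ^ k)

/-- For `‖q‖ < 1`, the infinite symbol is the limit of the finite ones. -/
theorem tendsto_qPoch (a : ℂ) {q : ℂ} (hq : ‖q‖ < 1) :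
    Filter.Tendsto (qPoch a q) Filter.atTop (nhds (qPochInf a q)) := by
  have h : Multipliable fun k : ℕ => 1 + (-(a * q ^ k)) := by
    apply multipliable_one_add_of_summable
    simpa [norm_mul, norm_pow] using
      (summable_geometric_of_lt_one (norm_nonneg q) hq).mul_left ‖a‖
  have h2 := h.hasProd.tendsto_prod_nat
  simp only [← sub_eq_add_neg] at h2
  exact h2

/-! ### Partitions

A partition is the list of its parts in nonincreasing order; in the classes `POmega` and `PNu`
the smallest part may be `0`. The length is `List.length` and the size is `List.sum`. -/

/-- The last entry; for a nonincreasing list this is the smallest part. -/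
def lastPart (l : List ℕ) : ℕ := l.getLastD 0

/-- The last entry but one. -/
def penultimatePart (l : List ℕ) : ℕ := lastPart l.dropLast

/-- Partitions with a unique smallest part (possibly `0`) all of whose odd parts are at most
twice the smallest part plus one. -/
def POmega : Set (List ℕ) :=
  {l | l ≠ [] ∧ l.Pairwise (· ≥ ·) ∧ (∀ a ∈ l.dropLast, lastPart l < a) ∧
    ∀ a ∈ l, Odd a → a ≤ 2 * lastPart l + 1}

/-- Partitions into distinct parts, the smallest one possibly `0`, all of whose odd parts are
less than twice the smallest part. -/
def PNu : Set (List ℕ) :=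
  {l | l ≠ [] ∧ l.Pairwise (· > ·) ∧ ∀ a ∈ l, Odd a → a < 2 * lastPart l}

/-- The members of `POmega` of length `m + 1` and size `n`. -/
def POmegaClass (m n : ℕ) : Set (List ℕ) := {l ∈ POmega | l.length = m + 1 ∧ l.sum = n}

/-- The members of `PNu` of length `m + 1` and size `n`. -/
def PNuClass (m n : ℕ) : Set (List ℕ) := {l ∈ PNu | l.length = m + 1 ∧ l.sum = n}

/-! ### Odd Ferrers graphs

An odd Ferrers graph is determined by its shape, a nonempty partition into positive parts, and is
represented by it. Box `(i, j)` (row `i`, column `j`, both counted from `0`) is filled by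
`boxEntry i j`. -/

/-- `0` in the corner, `1` in the rest of the first row and of the first column, `2` elsewhere. -/
def boxEntry (i j : ℕ) : ℕ :=
  if i = 0 ∧ j = 0 then 0 else if i = 0 ∨ j = 0 then 1 else 2

/-- The size of the odd Ferrers graph of a shape: the sum of the numbers in all boxes. -/
def graphSize (l : List ℕ) : ℕ :=
  ∑ i ∈ Finset.range l.length, ∑ j ∈ Finset.range (l.getD i 0), boxEntry i j

/-- (Shapes of) odd Ferrers graphs. -/
def BOmega : Set (List ℕ) :=
  {l | l ≠ [] ∧ l.Pairwise (· ≥ ·) ∧ ∀ a ∈ l, 0 < a}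

/-- (Shapes of) distinct odd Ferrers graphs. -/
def BNu : Set (List ℕ) :=
  {l | l ≠ [] ∧ l.Pairwise (· > ·) ∧ ∀ a ∈ l, 0 < a}

/-- Odd Ferrers graphs of size `n` with `m + 1` rows. -/
def BOmegaClass (m n : ℕ) : Set (List ℕ) := {l ∈ BOmega | l.length = m + 1 ∧ graphSize l = n}

/-- Distinct odd Ferrers graphs of size `n` with `m + 1` rows. -/
def BNuClass (m n : ℕ) : Set (List ℕ) := {l ∈ BNu | l.length = m + 1 ∧ graphSize l = n}

/-! ### Elementary operators on partitions

Natural-number subtraction never truncates where these operators are applied below to members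
of the classes above. -/

/-- Rearrangement in nonincreasing order. -/
def sortDesc (l : List ℕ) : List ℕ := l.insertionSort (· ≥ ·)

/-- Discards zero parts. -/
def dropZeros (l : List ℕ) : List ℕ := l.filter (fun a => 0 < a)

/-- One of the largest odd parts (`0` if there is no odd part). -/
def largestOdd (l : List ℕ) : ℕ := (l.filter (fun a => a % 2 = 1)).foldr max 0

/-- `φ⁺`: the last part is increased by one. -/
def phiPlus (l : List ℕ) : List ℕ := sortDesc (l.dropLast ++ [lastPart l + 1])

/-- `φ⁻`: the last part is decreased by one. -/
def phiMinus (l : List ℕ) : List ℕ := l.dropLast ++ [lastPart l - 1]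

/-- `φ⁺_c`: a largest odd part `a` is replaced by `(a + 1) / 2` and `(a - 1) / 2`. -/
def phiCPlus (l : List ℕ) : List ℕ :=
  sortDesc (l.erase (largestOdd l) ++ [(largestOdd l + 1) / 2, (largestOdd l - 1) / 2])

/-- `φ⁻_c`: the last two parts are replaced by their sum. -/
def phiCMinus (l : List ℕ) : List ℕ :=
  sortDesc (l.dropLast.dropLast ++ [penultimatePart l + lastPart l])

/-- `φ⁺_e`: all parts are increased by two. -/
def phiEPlus (l : List ℕ) : List ℕ := l.map (· + 2)

/-- `φ⁻_e`: all parts are decreased by two. -/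
def phiEMinus (l : List ℕ) : List ℕ := l.map (· - 2)

/-- `φ⁺_o`: the last part is increased by one and the others by two. -/
def phiOPlus (l : List ℕ) : List ℕ := l.dropLast.map (· + 2) ++ [lastPart l + 1]

/-- `φ⁻_o`: the last part is decreased by one and the others by two. -/
def phiOMinus (l : List ℕ) : List ℕ :=
  sortDesc (l.dropLast.map (· - 2) ++ [lastPart l - 1])

/-- `φ*`: all parts are decreased by one. -/
def phiStar (l : List ℕ) : List ℕ := l.map (· - 1)

/-! ### Destructive and constructive operators -/

/-- The destructive operator `ψ⁻` on `POmega` (for length at least two). -/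
def psiMinus (l : List ℕ) : List ℕ :=
  if lastPart l = 0 ∧ 2 ≤ penultimatePart l then phiMinus l.dropLast
  else if penultimatePart l = lastPart l + 1 then phiMinus (phiCMinus l)
  else phiOMinus l

/-- The constructive operator `ψ⁺₁` on `POmega`. -/
def psiPlusOne (l : List ℕ) : List ℕ :=
  if Odd (lastPart l) ∧ ∀ a ∈ l.dropLast, Even a then phiPlus l ++ [0]
  else phiCPlus (phiPlus l)

/-- The constructive operator `ψ⁺₂` on `POmega`. -/
def psiPlusTwo (l : List ℕ) : List ℕ := phiOPlus l

/-- The destructive operator `ρ⁻` on `PNu` (for length at least two). -/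
def rhoMinus (l : List ℕ) : List ℕ :=
  if lastPart l = 0 then phiEMinus l.dropLast
  else if penultimatePart l = lastPart l + 1 then phiEMinus (phiCMinus l)
  else phiOMinus l

/-- The constructive operator `ρ⁺₁` on `PNu`. -/
def rhoPlusOne (l : List ℕ) : List ℕ :=
  if ∀ a ∈ l, Even a then phiEPlus l ++ [0]
  else phiCPlus (phiEPlus l)

/-- The constructive operator `ρ⁺₂` on `PNu`. -/
def rhoPlusTwo (l : List ℕ) : List ℕ := phiOPlus l

/-! ### The bijections -/

/-- The first `i` for which the `i`-th iterate of `f` on `l` has length one. -/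
noncomputable def stopTime (f : List ℕ → List ℕ) (l : List ℕ) : ℕ :=
  sInf {i | (f^[i] l).length = 1}

/-- The sequence of the size differences between consecutive iterates, up to `stopTime`. -/
noncomputable def diffSeq (f : List ℕ → List ℕ) (size : List ℕ → ℕ) (l : List ℕ) : List ℕ :=
  (List.range (stopTime f l)).map fun i => size (f^[i] l) - size (f^[i + 1] l)

/-- The iterate of length one at which the procedure stops. -/
noncomputable def terminal (f : List ℕ → List ℕ) (l : List ℕ) : List ℕ :=
  f^[stopTime f l] l

/-- One step of building an odd Ferrers graph: for the difference `1` a new row consisting of one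
box is added, otherwise one box is added at the end of each row. -/
def growOmega (d : ℕ) (l : List ℕ) : List ℕ :=
  if d = 1 then l ++ [1] else l.map (· + 1)

/-- One step of building a distinct odd Ferrers graph: one box is added at the end of each row
and, if the difference is even, also a new row consisting of one box. -/
def growNu (d : ℕ) (l : List ℕ) : List ℕ :=
  if Even d then l.map (· + 1) ++ [1] else l.map (· + 1)

/-- From partitions to odd Ferrers graphs: iterate `ψ⁻` down to a single part, record the size
differences `d₁, …, d_t`, and grow a graph by them in the order `d_t, …, d₁`, starting from one
row of the size of the remaining part. -/
noncomputable def omegaToGraph (l : List ℕ) : List ℕ :=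
  (diffSeq psiMinus List.sum l).foldr growOmega [(terminal psiMinus l).sum + 1]

/-- The same procedure for distinct partitions, with `ρ⁻`. -/
noncomputable def nuToGraph (l : List ℕ) : List ℕ :=
  (diffSeq rhoMinus List.sum l).foldr growNu [(terminal rhoMinus l).sum + 1]

/-- One step of dismantling an odd Ferrers graph: the last box of each row is deleted if the last
row has at least two boxes, otherwise the single box of the last row is deleted. -/
def shrinkOmega (l : List ℕ) : List ℕ :=
  if 2 ≤ lastPart l then phiStar l else dropZeros (phiMinus l)

/-- One step of dismantling a distinct odd Ferrers graph: the last box of each row is deleted. -/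
def shrinkNu (l : List ℕ) : List ℕ := dropZeros (phiStar l)

/-- One step of building a partition in `POmega`. -/
def buildOmega (h : ℕ) (l : List ℕ) : List ℕ :=
  if h = 1 then psiPlusOne l else psiPlusTwo l

/-- One step of building a partition in `PNu`. -/
def buildNu (h : ℕ) (l : List ℕ) : List ℕ :=
  if Even h then rhoPlusOne l else rhoPlusTwo l

/-- From odd Ferrers graphs to partitions: dismantle the graph down to a single row, record the
size differences `h₁, …, h_r`, and apply `ψ⁺₁` and `ψ⁺₂` according to `h_r, …, h₁`, starting from
one part equal to the size of the remaining row. -/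
noncomputable def graphToOmega (l : List ℕ) : List ℕ :=
  (diffSeq shrinkOmega graphSize l).foldr buildOmega [graphSize (terminal shrinkOmega l)]

/-- The same procedure for distinct odd Ferrers graphs, with `ρ⁺₁` and `ρ⁺₂`. -/
noncomputable def graphToNu (l : List ℕ) : List ℕ :=
  (diffSeq shrinkNu graphSize l).foldr buildNu [graphSize (terminal shrinkNu l)]

/-! ### The terms of the series -/

/-- `q^n / ((zq^n;q)_{n+1} (zq^{2n+2};q²)_∞)`. -/
noncomputable def omegaOriginalTerm (z q : ℂ) (n : ℕ) : ℂ :=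
  q ^ n / (qPoch (z * q ^ n) q (n + 1) * qPochInf (z * q ^ (2 * n + 2)) (q ^ 2))

/-- `z^n q^{2n²+2n+1} / ((q;q²)_{n+1} (zq;q²)_{n+1})`. -/
noncomputable def omegaOriginalMockTerm (z q : ℂ) (n : ℕ) : ℂ :=
  z ^ n * q ^ (2 * n ^ 2 + 2 * n + 1) / (qPoch q (q ^ 2) (n + 1) * qPoch (z * q) (q ^ 2) (n + 1))

/-- `q^n / ((zq^{n+1};q)_{n+2} (zq^{2n+4};q²)_∞)`. -/
noncomputable def omegaTerm (z q : ℂ) (n : ℕ) : ℂ :=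
  q ^ n / (qPoch (z * q ^ (n + 1)) q (n + 2) * qPochInf (z * q ^ (2 * n + 4)) (q ^ 2))

/-- `z^n q^{2n²+2n} / ((q;q²)_{n+1} (zq;q²)_{n+1})`. -/
noncomputable def omegaMockTerm (z q : ℂ) (n : ℕ) : ℂ :=
  z ^ n * q ^ (2 * n ^ 2 + 2 * n) / (qPoch q (q ^ 2) (n + 1) * qPoch (z * q) (q ^ 2) (n + 1))

/-- `q^n (-zq^{n+1};q)_n (-zq^{2n+2};q²)_∞`. -/
noncomputable def nuTerm (z q : ℂ) (n : ℕ) : ℂ :=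
  q ^ n * qPoch (-(z * q ^ (n + 1))) q n * qPochInf (-(z * q ^ (2 * n + 2))) (q ^ 2)

/-- `z^n q^{n²+n} / (q;q²)_{n+1}`. -/
noncomputable def nuMockTerm (z q : ℂ) (n : ℕ) : ℂ :=
  z ^ n * q ^ (n ^ 2 + n) / qPoch q (q ^ 2) (n + 1)

/-- The term `|C(m,n)| z^m q^n` of the generating function of a doubly indexed family of
finite classes `C(m,n)`. -/
noncomputable def genTerm (C : ℕ → ℕ → Set (List ℕ)) (z q : ℂ) (p : ℕ × ℕ) : ℂ :=
  ((C p.1 p.2).ncard : ℂ) * z ^ p.1 * q ^ p.2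

end AndrewsYee

namespace AndrewsYee

open Filter Topology

/-! ### Products -/

/-! Identities. Both sides of the shifted first identity, as functions of z, solve (1 - zq) F(z) = 1
+ q F(zq²) (`tsum_omegaTerm_functional`, `tsum_omegaMockTerm_functional`). The difference D of two
solutions satisfies D(z) = q/(1 - zq) · D(zq²). Along the orbit zq^(2k) the coefficient tends to q,
of norm below 1, and D stays bounded near 0, so D(z) = 0 (`eq_zero_of_contracting`,
`tsum_eq_of_functional`). The second identity follows in the same way from F(z) = 1 + (q + zq²)
F(zq²).

Bijections. All four classes follow one pattern, `StepSystem`: each member of length at least two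
arises in exactly one way by a row step, which raises the length ℓ by 1 and the size by e(ℓ), or by
a column step, which keeps ℓ and raises the size by 2ℓ - 1. Here e(ℓ) = 1 in the omega case and e(ℓ)
= 2ℓ in the nu case. A partition class and its graph class have the same increments, so the size
differences recorded in one can be replayed in the other and played back
(`StepSystem.transform_spec`).

Generating functions. The pattern determines the counting recurrence, and the members of length m +
1 have generating function q^(e(1)+⋯+e(m)) / (q;q²)_{m+1} (`StepSystem.hasSum_ncard`). For e(ℓ) = 2ℓ
this is, up to z^m, the term of the second mock series. For e = 1 the series Σ z^m q^m /
(q;q²)_{m+1} is a third solution of the first functional equation (`tsum_omegaRowTerm_eq`). The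
partition classes inherit these results through the bijections, and the left sides through the
identities; the products on the left are never expanded combinatorially. -/

theorem qPoch_zero (a q : ℂ) : qPoch a q 0 = 1 := by simp [qPoch]

theorem qPoch_succ (a q : ℂ) (n : ℕ) : qPoch a q (n + 1) = qPoch a q n * (1 - a * q ^ n) :=
  Finset.prod_range_succ _ _

theorem qPoch_succ' (a q : ℂ) (n : ℕ) : qPoch a q (n + 1) = (1 - a) * qPoch (a * q) q n := by
  unfold qPoch
  rw [Finset.prod_range_succ', mul_comm]
  simp [pow_succ', mul_assoc]

theorem qPochInf_eq (a : ℂ) {q : ℂ} (hq : ‖q‖ < 1) :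
    qPochInf a q = (1 - a) * qPochInf (a * q) q := by
  have h1 := (tendsto_qPoch a hq).comp (tendsto_add_atTop_nat 1)
  have h2 := (tendsto_qPoch (a * q) hq).const_mul (1 - a)
  refine tendsto_nhds_unique h1 (h2.congr fun n => ?_)
  exact (qPoch_succ' a q n).symm

theorem qPoch_ne_zero {a q : ℂ} {n : ℕ} (h : ∀ k < n, a * q ^ k ≠ 1) : qPoch a q n ≠ 0 := by
  unfold qPoch
  rw [Finset.prod_ne_zero_iff]
  intro k hk
  exact sub_ne_zero.2 (h k (Finset.mem_range.1 hk)).symm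

theorem pow_ne_one_of_norm_lt_one {q : ℂ} (hq : ‖q‖ < 1) {k : ℕ} (hk : k ≠ 0) : q ^ k ≠ 1 := by
  intro h
  have h1 : ‖q‖ ^ k = 1 := by rw [← norm_pow, h, norm_one]
  exact (pow_lt_one₀ (norm_nonneg _) hq hk).ne h1

theorem norm_sq_lt_one {q : ℂ} (hq : ‖q‖ < 1) : ‖q ^ 2‖ < 1 := by
  rw [norm_pow]
  exact pow_lt_one₀ (norm_nonneg _) hq two_ne_zero

theorem qPoch_self_sq_ne_zero {q : ℂ} (hq : ‖q‖ < 1) (n : ℕ) : qPoch q (q ^ 2) n ≠ 0 := by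
  apply qPoch_ne_zero
  intro k _
  rw [← pow_mul, ← pow_succ']
  exact pow_ne_one_of_norm_lt_one hq (by omega)

/-- The exponents add up to at most a geometric series, whatever n is. Uniformity in n lets the
bound pass to the infinite product. -/
theorem norm_qPoch_sub_one_le (a : ℂ) {q : ℂ} (hq : ‖q‖ < 1) (n : ℕ) :
    ‖qPoch a q n - 1‖ ≤ Real.exp (‖a‖ / (1 - ‖q‖)) - 1 := by
  have h := (Finset.range n).norm_prod_one_add_sub_one_le fun k => -(a * q ^ k)
  simp only [← sub_eq_add_neg] at h
  refine h.trans (sub_le_sub_right (Real.exp_le_exp.2 ?_) 1)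
  simp only [norm_neg, norm_mul, norm_pow]
  rw [← Finset.mul_sum, div_eq_mul_inv]
  refine mul_le_mul_of_nonneg_left ?_ (norm_nonneg _)
  rw [← tsum_geometric_of_lt_one (norm_nonneg q) hq]
  exact (summable_geometric_of_lt_one (norm_nonneg q) hq).sum_le_tsum _ fun _ _ => by positivity

theorem norm_qPochInf_sub_one_le (a : ℂ) {q : ℂ} (hq : ‖q‖ < 1) :
    ‖qPochInf a q - 1‖ ≤ Real.exp (‖a‖ / (1 - ‖q‖)) - 1 :=
  le_of_tendsto ((tendsto_qPoch a hq).sub_const 1).norm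
    (Eventually.of_forall fun n => norm_qPoch_sub_one_le a hq n)

theorem norm_mul_sub_one_le {x y : ℂ} {s t : ℝ} (hx : ‖x - 1‖ ≤ Real.exp s - 1)
    (hy : ‖y - 1‖ ≤ Real.exp t - 1) : ‖x * y - 1‖ ≤ Real.exp (s + t) - 1 := by
  have h : x * y - 1 = (x - 1) * (y - 1) + (x - 1) + (y - 1) := by ring
  rw [h, Real.exp_add]
  have h1 := norm_add₃_le (a := (x - 1) * (y - 1)) (b := x - 1) (c := y - 1)
  have h2 : ‖(x - 1) * (y - 1)‖ ≤ (Real.exp s - 1) * (Real.exp t - 1) := by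
    rw [norm_mul]
    exact mul_le_mul hx hy (norm_nonneg _) ((norm_nonneg _).trans hx)
  linarith

/-- Each of the two products contributes at most ‖a‖ / (1 - ‖q‖) to the exponent; the base q² only
improves the second one. This explains the factor 2. -/
theorem norm_qPoch_mul_qPochInf_sub_one_le {a b q : ℂ} (hq : ‖q‖ < 1) (hb : ‖b‖ ≤ ‖a‖) (n : ℕ) :
    ‖qPoch a q n * qPochInf b (q ^ 2) - 1‖ ≤ Real.exp (2 * ‖a‖ / (1 - ‖q‖)) - 1 := by
  have h0 : 0 < 1 - ‖q‖ := by linarith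
  have h1 : ‖q ^ 2‖ ≤ ‖q‖ := by
    rw [norm_pow, sq]
    exact mul_le_of_le_one_left (norm_nonneg _) hq.le
  refine (norm_mul_sub_one_le (norm_qPoch_sub_one_le a hq n)
    (norm_qPochInf_sub_one_le b (norm_sq_lt_one hq))).trans ?_
  refine sub_le_sub_right (Real.exp_le_exp.2 ?_) 1
  have h2 : ‖b‖ / (1 - ‖q ^ 2‖) ≤ ‖a‖ / (1 - ‖q‖) := by gcongr
  calc _ ≤ ‖a‖ / (1 - ‖q‖) + ‖a‖ / (1 - ‖q‖) := by gcongr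
    _ = _ := by ring

theorem norm_mul_pow_le (z : ℂ) {q : ℂ} (hq : ‖q‖ < 1) {i j : ℕ} (h : i ≤ j) :
    ‖z * q ^ j‖ ≤ ‖z * q ^ i‖ := by
  rw [norm_mul, norm_mul, norm_pow, norm_pow]
  exact mul_le_mul_of_nonneg_left (pow_le_pow_of_le_one (norm_nonneg _) hq.le h) (norm_nonneg _)

theorem tendsto_mul_pow_zero (z : ℂ) {q : ℂ} (hq : ‖q‖ < 1) {g : ℕ → ℕ}
    (hg : Tendsto g atTop atTop) : Tendsto (fun n => z * q ^ g n) atTop (𝓝 0) := by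
  simpa using ((tendsto_pow_atTop_nhds_zero_of_norm_lt_one hq).comp hg).const_mul z

theorem tendsto_div_of_tendsto_one {f g : ℕ → ℂ} {a : ℂ} (hf : Tendsto f atTop (𝓝 a))
    (hg : Tendsto g atTop (𝓝 1)) : Tendsto (fun n => f n / g n) atTop (𝓝 a) := by
  rw [← div_one a]
  exact hf.div hg one_ne_zero

/-! ### Recursions with a contracting coefficient -/

/-- From some index on the coefficients have norm at most s < 1, so j steps of the recursion bound D
by s^j M for every j. -/
theorem eq_zero_of_contracting {D c : ℕ → ℂ} {r : ℂ} (hr : ‖r‖ < 1) (hc : Tendsto c atTop (𝓝 r))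
    (h : ∀ k, D k = c k * D (k + 1)) {M : ℝ} (hM : ∀ᶠ k in atTop, ‖D k‖ ≤ M) : D 0 = 0 := by
  obtain ⟨s, hs1, hs2⟩ := exists_between hr
  have hs0 : 0 ≤ s := (norm_nonneg _).trans hs1.le
  obtain ⟨K, hK⟩ := eventually_atTop.1 ((hc.norm.eventually (gt_mem_nhds hs1)).and hM)
  have h1 : ∀ j k, K ≤ k → ‖D k‖ ≤ s ^ j * M := by
    intro j
    induction j with
    | zero => intro k hk; simpa using (hK k hk).2
    | succ j ih =>
      intro k hk
      rw [h k, norm_mul, pow_succ', mul_assoc]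
      exact mul_le_mul (hK k hk).1.le (ih (k + 1) (by omega)) (norm_nonneg _) hs0
  have h2 : D K = 0 := by
    rw [← norm_le_zero_iff]
    have h3 : Tendsto (fun j : ℕ => s ^ j * M) atTop (𝓝 0) := by
      simpa using (tendsto_pow_atTop_nhds_zero_of_lt_one hs0 hs2).mul_const M
    exact ge_of_tendsto' h3 fun j => h1 j K le_rfl
  -- Below K the coefficients may be large, but a zero propagates downwards regardless of them.
  have h4 : ∀ i ≤ K, D (K - i) = 0 := by
    intro i
    induction i with
    | zero => intro _; simpa using h2
    | succ i ih =>
      intro hi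
      rw [h, show K - (i + 1) + 1 = K - i by omega, ih (by omega), mul_zero]
  simpa using h4 K le_rfl

/-- Summability has to be known beforehand; telescoping only identifies the value. -/
theorem hasSum_telescope {u E : ℕ → ℂ} (hu : Summable u) (h : ∀ n, u n = E (n + 1) - E n) {a : ℂ}
    (hE : Tendsto E atTop (𝓝 a)) : HasSum u (a - E 0) := by
  have h1 : Tendsto (fun n => ∑ i ∈ Finset.range n, u i) atTop (𝓝 (a - E 0)) := by
    simp only [h, Finset.sum_range_sub]
    exact hE.sub_const _
  rw [← tendsto_nhds_unique hu.hasSum.tendsto_sum_nat h1]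
  exact hu.hasSum

theorem summable_of_ratio_tendsto {t ρ : ℕ → ℂ} {r : ℂ} (hr : ‖r‖ < 1)
    (hρ : Tendsto ρ atTop (𝓝 r)) (h : ∀ n, t (n + 1) = ρ n * t n) : Summable t := by
  obtain ⟨s, hs1, hs2⟩ := exists_between hr
  refine summable_of_ratio_norm_eventually_le hs2 ?_
  filter_upwards [hρ.norm.eventually (gt_mem_nhds hs1)] with n hn
  rw [h n, norm_mul]
  exact mul_le_mul_of_nonneg_right hn.le (norm_nonneg _)

/-! ### The products with all exponents in an interval and all larger even exponents -/

/-- The product of `1 - z q ^ j` over all `j` from `n + 1` to `2n` and all even `j > 2n`. -/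
noncomputable def mixedProd (z q : ℂ) (n : ℕ) : ℂ :=
  qPoch (z * q ^ (n + 1)) q n * qPochInf (z * q ^ (2 * n + 2)) (q ^ 2)

/-- The denominator in `omegaTerm`. -/
noncomputable def omegaDenom (z q : ℂ) (n : ℕ) : ℂ :=
  qPoch (z * q ^ (n + 1)) q (n + 2) * qPochInf (z * q ^ (2 * n + 4)) (q ^ 2)

/-- The exponents in the denominator are n+1, …, 2n+2 and all larger even numbers. Removing the odd
exponent 2n+1 leaves the n-th mixed product, removing n+1 leaves the next one
(`omegaDenom_eq_succ`). The two factorisations make the first series telescope. -/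
theorem omegaDenom_eq (z : ℂ) {q : ℂ} (hq : ‖q‖ < 1) (n : ℕ) :
    omegaDenom z q n = mixedProd z q n * (1 - z * q ^ (2 * n + 1)) := by
  unfold omegaDenom mixedProd
  rw [qPochInf_eq (z * q ^ (2 * n + 2)) (norm_sq_lt_one hq), qPoch_succ, qPoch_succ]
  have h1 : z * q ^ (2 * n + 2) * q ^ 2 = z * q ^ (2 * n + 4) := by ring
  have h2 : z * q ^ (n + 1) * q ^ n = z * q ^ (2 * n + 1) := by ring
  have h3 : z * q ^ (n + 1) * q ^ (n + 1) = z * q ^ (2 * n + 2) := by ring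
  rw [h1, h2, h3]
  ring

theorem omegaDenom_eq_succ (z q : ℂ) (n : ℕ) :
    omegaDenom z q n = (1 - z * q ^ (n + 1)) * mixedProd z q (n + 1) := by
  unfold omegaDenom mixedProd
  rw [qPoch_succ', ← mul_assoc]
  ring_nf

theorem omegaDenom_mul_sq (z q : ℂ) (n : ℕ) :
    omegaDenom (z * q ^ 2) q n = mixedProd z q (n + 2) := by
  unfold omegaDenom mixedProd
  ring_nf

theorem mixedProd_succ (z q : ℂ) (n : ℕ) :
    mixedProd z q (n + 1) = (1 - z * q ^ (n + 2)) * mixedProd (z * q ^ 2) q n := by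
  unfold mixedProd
  rw [qPoch_succ', ← mul_assoc]
  ring_nf

theorem mixedProd_add_two (z : ℂ) {q : ℂ} (hq : ‖q‖ < 1) (n : ℕ) :
    mixedProd z q (n + 2) = (1 - z * q ^ (2 * n + 3)) * mixedProd (z * q ^ 2) q n := by
  rw [← omegaDenom_mul_sq, omegaDenom_eq _ hq]
  ring

/-- Both products run over all even exponents from 2 on. Owing to this coincidence the boundary
terms cancel in both functional equations. -/
theorem mixedProd_one (z : ℂ) {q : ℂ} (hq : ‖q‖ < 1) : mixedProd z q 1 = mixedProd z q 0 := by
  rw [mixedProd_succ]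
  unfold mixedProd
  rw [qPochInf_eq (z * q ^ (2 * 0 + 2)) (norm_sq_lt_one hq), qPoch_zero, qPoch_zero]
  ring_nf

theorem norm_mixedProd_sub_one_le (z : ℂ) {q : ℂ} (hq : ‖q‖ < 1) (n : ℕ) :
    ‖mixedProd z q n - 1‖ ≤ Real.exp (2 * ‖z * q ^ (n + 1)‖ / (1 - ‖q‖)) - 1 :=
  norm_qPoch_mul_qPochInf_sub_one_le hq (norm_mul_pow_le z hq (by omega)) n

theorem norm_omegaDenom_sub_one_le (z : ℂ) {q : ℂ} (hq : ‖q‖ < 1) (n : ℕ) :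
    ‖omegaDenom z q n - 1‖ ≤ Real.exp (2 * ‖z * q ^ (n + 1)‖ / (1 - ‖q‖)) - 1 :=
  norm_qPoch_mul_qPochInf_sub_one_le hq (norm_mul_pow_le z hq (by omega)) (n + 2)

theorem tendsto_mixedProd (z : ℂ) {q : ℂ} (hq : ‖q‖ < 1) :
    Tendsto (mixedProd z q) atTop (𝓝 1) := by
  rw [tendsto_iff_norm_sub_tendsto_zero]
  have h1 := (tendsto_mul_pow_zero z hq (tendsto_add_atTop_nat 1)).norm
  have h2 : Tendsto (fun n : ℕ => Real.exp (2 * ‖z * q ^ (n + 1)‖ / (1 - ‖q‖)) - 1) atTop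
      (𝓝 (Real.exp (2 * ‖(0 : ℂ)‖ / (1 - ‖q‖)) - 1)) :=
    ((Real.continuous_exp.tendsto _).comp ((h1.const_mul 2).div_const _)).sub_const 1
  simp only [norm_zero, mul_zero, zero_div, Real.exp_zero, sub_self] at h2
  exact squeeze_zero (fun _ => norm_nonneg _) (norm_mixedProd_sub_one_le z hq) h2

/-- The radius depends on q alone, so all the products above are within 1/2 of 1 for every n at
once. -/
theorem exists_norm_bound (q : ℂ) :
    ∃ δ > 0, ∀ w : ℂ, ‖w‖ < δ → Real.exp (2 * ‖w‖ / (1 - ‖q‖)) - 1 ≤ 1 / 2 := by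
  have hc : Continuous fun w : ℂ => Real.exp (2 * ‖w‖ / (1 - ‖q‖)) - 1 := by fun_prop
  have h := hc.tendsto 0
  simp only [norm_zero, mul_zero, zero_div, Real.exp_zero, sub_self] at h
  obtain ⟨δ, h0, h1⟩ := Metric.eventually_nhds_iff.1 (h.eventually (gt_mem_nhds
    (show (0 : ℝ) < 1 / 2 by norm_num)))
  exact ⟨δ, h0, fun w hw => (h1 (by simpa using hw)).le⟩

theorem half_le_norm {x : ℂ} (h : ‖x - 1‖ ≤ 1 / 2) : 1 / 2 ≤ ‖x‖ := by
  have h1 := norm_sub_norm_le 1 x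
  rw [norm_one, norm_sub_rev] at h1
  linarith

/-! ### The left side of the first identity -/

theorem omegaTerm_eq (z q : ℂ) (n : ℕ) : omegaTerm z q n = q ^ n / omegaDenom z q n := rfl

/-- Smallness is required of zq^(n+1) and not of z, so that the bound serves twice: for fixed z and
large n (summability), and for small z and all n (boundedness near 0). -/
theorem exists_norm_omegaTerm_le {q : ℂ} (hq : ‖q‖ < 1) :
    ∃ δ > 0, ∀ (z : ℂ) (n : ℕ), ‖z * q ^ (n + 1)‖ < δ → ‖omegaTerm z q n‖ ≤ 2 * ‖q‖ ^ n := by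
  obtain ⟨δ, h0, h⟩ := exists_norm_bound q
  refine ⟨δ, h0, fun z n hz => ?_⟩
  have h1 := half_le_norm ((norm_omegaDenom_sub_one_le z hq n).trans (h _ hz))
  rw [omegaTerm_eq, norm_div, norm_pow, div_le_iff₀ (by linarith)]
  nlinarith [pow_nonneg (norm_nonneg q) n]

theorem summable_omegaTerm (z : ℂ) {q : ℂ} (hq : ‖q‖ < 1) : Summable (omegaTerm z q) := by
  obtain ⟨δ, h0, h⟩ := exists_norm_omegaTerm_le hq
  have h1 := (tendsto_mul_pow_zero z hq (tendsto_add_atTop_nat 1)).norm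
  rw [norm_zero] at h1
  refine Summable.of_norm_bounded_eventually_nat
    ((summable_geometric_of_lt_one (norm_nonneg q) hq).mul_left 2) ?_
  filter_upwards [h1.eventually (gt_mem_nhds h0)] with n hn
  exact h z n hn

/-- With M_n the mixed products, (1 - zq) q^n / `omegaDenom` n - q^n / M_{n+1} equals 1/M_{n+1} -
1/M_n. The sum of q^n / M_{n+1} is 1/M_1 plus q times the series at zq², because `omegaDenom` at zq²
is M_{n+2}. -/
theorem tsum_omegaTerm_functional {z q : ℂ} (hq : ‖q‖ < 1) (hz : ∀ k : ℕ, 1 ≤ k → z * q ^ k ≠ 1) :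
    (1 - z * q) * ∑' n, omegaTerm z q n = 1 + q * ∑' n, omegaTerm (z * q ^ 2) q n := by
  have hfac : ∀ k : ℕ, 1 - z * q ^ (k + 1) ≠ 0 := fun k =>
    sub_ne_zero.2 (hz (k + 1) (by omega)).symm
  have hD : ∀ n, (omegaDenom z q n)⁻¹ * (1 - z * q ^ (2 * n + 1)) = (mixedProd z q n)⁻¹ := by
    intro n
    rw [omegaDenom_eq z hq, mul_inv, mul_assoc, inv_mul_cancel₀ (hfac _), mul_one]
  have hD' : ∀ n, (omegaDenom z q n)⁻¹ * (1 - z * q ^ (n + 1)) = (mixedProd z q (n + 1))⁻¹ := by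
    intro n
    rw [omegaDenom_eq_succ, mul_inv, mul_right_comm, inv_mul_cancel₀ (hfac _), one_mul]
  have hS := (summable_omegaTerm z hq).hasSum
  have hS' := (summable_omegaTerm (z * q ^ 2) hq).hasSum
  have h1 : HasSum (fun n => q ^ n * (mixedProd z q (n + 1))⁻¹)
      (q * ∑' n, omegaTerm (z * q ^ 2) q n + (mixedProd z q 1)⁻¹) := by
    have h : HasSum (fun n => q ^ (n + 1) * (mixedProd z q (n + 1 + 1))⁻¹)
        (q * ∑' n, omegaTerm (z * q ^ 2) q n) := by
      refine (hS'.mul_left q).congr_fun fun n => ?_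
      rw [omegaTerm_eq, omegaDenom_mul_sq]
      ring
    simpa using (hasSum_nat_add_iff (f := fun n => q ^ n * (mixedProd z q (n + 1))⁻¹) 1).1 h
  have h2 := (hS.mul_left (1 - z * q)).sub h1
  -- This limit is the constant 1 of the functional equation.
  have hE : Tendsto (fun n => (mixedProd z q n)⁻¹) atTop (𝓝 1) := by
    simpa using (tendsto_mixedProd z hq).inv₀ one_ne_zero
  have h3 := hasSum_telescope h2.summable (fun n => by
    rw [← hD n, ← hD' n, omegaTerm_eq]
    ring) hE
  have h4 := h2.unique h3
  rw [mixedProd_one z hq] at h4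
  linear_combination h4

/-! ### The mock theta side of the first identity -/

theorem omegaMockTerm_succ (z q : ℂ) (n : ℕ) : omegaMockTerm z q (n + 1) =
    z * q ^ (4 * n + 4) / ((1 - q ^ (2 * n + 3)) * (1 - z * q ^ (2 * n + 3))) *
      omegaMockTerm z q n := by
  unfold omegaMockTerm
  rw [qPoch_succ q, qPoch_succ (z * q), div_mul_div_comm]
  congr 1 <;> ring

theorem summable_omegaMockTerm (z : ℂ) {q : ℂ} (hq : ‖q‖ < 1) : Summable (omegaMockTerm z q) := by
  refine summable_of_ratio_tendsto (r := 0) (by simp) ?_ (omegaMockTerm_succ z q)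
  have hg : ∀ a b : ℕ, 1 ≤ a → Tendsto (fun n => a * n + b) atTop atTop := fun a b ha =>
    tendsto_atTop_mono
      (fun n => (Nat.le_mul_of_pos_left n ha).trans (Nat.le_add_right _ _)) tendsto_id
  have h1 := tendsto_mul_pow_zero z hq (hg 4 4 (by norm_num))
  have h2 := tendsto_mul_pow_zero z hq (hg 2 3 (by norm_num))
  have h3 := tendsto_mul_pow_zero 1 hq (hg 2 3 (by norm_num))
  simp only [one_mul] at h3
  exact tendsto_div_of_tendsto_one h1 (by simpa using (h3.const_sub 1).mul (h2.const_sub 1))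

theorem tsum_omegaMockTerm_functional {z q : ℂ} (hq : ‖q‖ < 1)
    (hz : ∀ k : ℕ, 1 ≤ k → z * q ^ k ≠ 1) :
    (1 - z * q) * ∑' n, omegaMockTerm z q n = 1 + q * ∑' n, omegaMockTerm (z * q ^ 2) q n := by
  have hfac : ∀ k : ℕ, 1 - z * q ^ (k + 1) ≠ 0 := fun k =>
    sub_ne_zero.2 (hz (k + 1) (by omega)).symm
  have hz1 : 1 - z * q ≠ 0 := by simpa using hfac 0
  have hq1 : ∀ k : ℕ, 1 - q ^ (k + 1) ≠ 0 := fun k =>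
    sub_ne_zero.2 (pow_ne_one_of_norm_lt_one hq (by omega)).symm
  have hZ : ∀ n, qPoch (z * q * q ^ 2) (q ^ 2) n ≠ 0 := fun n => qPoch_ne_zero fun k _ => by
    rw [show z * q * q ^ 2 * (q ^ 2) ^ k = z * q ^ (2 * k + 3) by ring]
    exact hz _ (by omega)
  have hS := summable_omegaMockTerm z hq
  have hS' := summable_omegaMockTerm (z * q ^ 2) hq
  have h2 := (hS.hasSum.mul_left (1 - z * q)).sub (hS'.hasSum.mul_left q)
  -- The antidifference: the n-th term of the combined series is T n - T (n+1). The extra factors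
  -- cancel the denominator at n = 0, so T 0 = 1.
  set T : ℕ → ℂ := fun n => omegaMockTerm z q n * ((1 - 1 * q ^ (2 * n + 1)) * (1 - z * q)) with hT
  have hTlim : Tendsto (fun n => -T n) atTop (𝓝 0) := by
    have h3 := tendsto_mul_pow_zero 1 hq (g := fun n => 2 * n + 1)
      (tendsto_atTop_mono (fun n => by dsimp; omega) tendsto_id)
    simpa [hT] using (hS.tendsto_atTop_zero.mul ((h3.const_sub 1).mul_const (1 - z * q))).neg
  have h3 := hasSum_telescope h2.summable (fun n => by
    simp only [hT, omegaMockTerm]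
    rw [qPoch_succ q _ (n + 1), qPoch_succ' (z * q), qPoch_succ' (z * q),
      show z * q ^ 2 * q = z * q * q ^ 2 by ring, qPoch_succ (z * q * q ^ 2)]
    have e1 : q * (q ^ 2) ^ (n + 1) = q ^ (2 * n + 2 + 1) := by ring
    have e2 : z * q * q ^ 2 * (q ^ 2) ^ n = z * q ^ (2 * n + 2 + 1) := by ring
    rw [e1, e2]
    have := hq1 (2 * n + 2)
    have := hfac (2 * n + 2)
    have := hZ n
    have := qPoch_self_sq_ne_zero hq (n + 1)
    field_simp
    ring) hTlim
  have h4 := h2.unique h3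
  have hT0 : T 0 = 1 := by
    have h5 : 1 - q ≠ 0 := by simpa using hq1 0
    simp only [hT, omegaMockTerm, qPoch_succ, qPoch_zero]
    simp
    field_simp
  rw [hT0] at h4
  linear_combination h4

/-- Every factor has norm at least 1 - ‖q‖. The exponential loss is harmless near z = 0, where ‖z‖^n
compensates for it. -/
theorem pow_le_norm_qPoch {q : ℂ} (hq : ‖q‖ < 1) (n : ℕ) :
    (1 - ‖q‖) ^ n ≤ ‖qPoch q (q ^ 2) n‖ := by
  unfold qPoch
  rw [norm_prod, ← Finset.card_range n, ← Finset.prod_const, Finset.card_range]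
  refine Finset.prod_le_prod (fun _ _ => by linarith) fun k _ => ?_
  have h := norm_sub_norm_le 1 (q * (q ^ 2) ^ k)
  have h1 : ‖q * (q ^ 2) ^ k‖ ≤ ‖q‖ := by
    rw [norm_mul]
    exact mul_le_of_le_one_right (norm_nonneg _) (by
      rw [norm_pow]; exact pow_le_one₀ (norm_nonneg _) (norm_sq_lt_one hq).le)
  rw [norm_one] at h
  linarith

/-- A bound near `z = 0`. -/
theorem exists_norm_omegaMockTerm_le {q : ℂ} (hq : ‖q‖ < 1) :
    ∃ δ > 0, ∀ (z : ℂ) (n : ℕ), ‖z‖ < δ →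
      ‖omegaMockTerm z q n‖ ≤ 2 / (1 - ‖q‖) * (1 / 2) ^ n := by
  have h01 : 0 < 1 - ‖q‖ := by linarith
  obtain ⟨δ, h0, h⟩ := exists_norm_bound (q ^ 2)
  -- The first radius keeps the product depending on z away from 0; the second leaves (1/2)^n after
  -- division by (1 - ‖q‖)^(n+1).
  refine ⟨min δ ((1 - ‖q‖) / 2), lt_min h0 (by linarith), fun z n hz => ?_⟩
  have hz1 : ‖z * q‖ < δ := by
    rw [norm_mul]
    exact (mul_le_of_le_one_right (norm_nonneg _) hq.le).trans_lt (lt_min_iff.1 hz).1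
  have hz2 := (lt_min_iff.1 hz).2.le
  have h1 : 1 / 2 ≤ ‖qPoch (z * q) (q ^ 2) (n + 1)‖ := by
    refine half_le_norm ((norm_qPoch_sub_one_le _ (norm_sq_lt_one hq) _).trans
      (le_trans ?_ (h _ hz1)))
    refine sub_le_sub_right (Real.exp_le_exp.2 ?_) 1
    have : 0 < 1 - ‖q ^ 2‖ := by linarith [norm_sq_lt_one hq]
    gcongr
    linarith [norm_nonneg (z * q)]
  have h2 := pow_le_norm_qPoch hq (n + 1)
  unfold omegaMockTerm
  rw [norm_div, norm_mul, norm_mul, norm_pow, norm_pow]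
  calc _ ≤ ((1 - ‖q‖) / 2) ^ n * 1 / ((1 - ‖q‖) ^ (n + 1) * (1 / 2)) := by
        gcongr
        exact pow_le_one₀ (norm_nonneg _) hq.le
    _ = _ := by
        rw [div_pow, pow_succ, one_div_pow]
        field_simp

/-! ### Uniqueness for the functional equation, and the first identity -/

theorem eventually_mul_pow_lt (z : ℂ) {q : ℂ} (hq : ‖q‖ < 1) {δ : ℝ} (hδ : 0 < δ) :
    ∀ᶠ k : ℕ in atTop, ‖z * q ^ (2 * k)‖ < δ := by
  have h := (tendsto_mul_pow_zero z hq (g := fun k => 2 * k)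
    (tendsto_atTop_mono (fun n => by dsimp; omega) tendsto_id)).norm
  rw [norm_zero] at h
  exact h.eventually (gt_mem_nhds hδ)

theorem exists_eventually_norm_tsum_le {F : ℂ → ℕ → ℂ} {z q : ℂ} (hq : ‖q‖ < 1) {g : ℕ → ℝ}
    (hg : Summable g) (h : ∃ δ > 0, ∀ (w : ℂ) (n : ℕ), ‖w‖ < δ → ‖F w n‖ ≤ g n) :
    ∃ M : ℝ, ∀ᶠ k : ℕ in atTop, ‖∑' n, F (z * q ^ (2 * k)) n‖ ≤ M := by
  obtain ⟨δ, h0, h⟩ := h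
  refine ⟨∑' n, g n, ?_⟩
  filter_upwards [eventually_mul_pow_lt z hq h0] with k hk
  exact tsum_of_norm_bounded hg.hasSum fun n => h _ n hk

/-- Solutions of `(1 - zq) F(z) = 1 + q F(zq²)` bounded near `z = 0` are unique. -/
theorem tsum_eq_of_functional {F G : ℂ → ℕ → ℂ} {z q : ℂ} (hq : ‖q‖ < 1)
    (hz : ∀ k : ℕ, 1 ≤ k → z * q ^ k ≠ 1) {f g : ℕ → ℝ} (hf : Summable f) (hg : Summable g)
    (hF : ∀ k : ℕ, (1 - z * q ^ (2 * k) * q) * ∑' n, F (z * q ^ (2 * k)) n =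
      1 + q * ∑' n, F (z * q ^ (2 * k) * q ^ 2) n)
    (hG : ∀ k : ℕ, (1 - z * q ^ (2 * k) * q) * ∑' n, G (z * q ^ (2 * k)) n =
      1 + q * ∑' n, G (z * q ^ (2 * k) * q ^ 2) n)
    (hFb : ∃ δ > 0, ∀ (w : ℂ) (n : ℕ), ‖w‖ < δ → ‖F w n‖ ≤ f n)
    (hGb : ∃ δ > 0, ∀ (w : ℂ) (n : ℕ), ‖w‖ < δ → ‖G w n‖ ≤ g n) :
    ∑' n, F z n = ∑' n, G z n := by
  obtain ⟨M, hM⟩ := exists_eventually_norm_tsum_le (z := z) hq hf hFb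
  obtain ⟨N, hN⟩ := exists_eventually_norm_tsum_le (z := z) hq hg hGb
  have hc : Tendsto (fun k : ℕ => q / (1 - z * q ^ (2 * k + 1))) atTop (𝓝 q) := by
    have h := tendsto_mul_pow_zero z hq (g := fun k => 2 * k + 1)
      (tendsto_atTop_mono (fun n => by dsimp; omega) tendsto_id)
    exact tendsto_div_of_tendsto_one tendsto_const_nhds (by simpa using h.const_sub 1)
  -- In the difference of the two solutions at zq^(2k) the constant 1 cancels, which leaves a
  -- homogeneous recursion with coefficient q / (1 - zq^(2k+1)).
  have hD := eq_zero_of_contracting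
    (D := fun k => ∑' n, F (z * q ^ (2 * k)) n - ∑' n, G (z * q ^ (2 * k)) n) hq hc (fun k => by
      have h1 := hF k
      have h2 := hG k
      rw [show z * q ^ (2 * k) * q = z * q ^ (2 * k + 1) by ring,
        show z * q ^ (2 * k) * q ^ 2 = z * q ^ (2 * (k + 1)) by ring] at h1 h2
      have h3 : 1 - z * q ^ (2 * k + 1) ≠ 0 := sub_ne_zero.2 (hz _ (by omega)).symm
      field_simp
      linear_combination h1 - h2) (M := M + N) (by
      filter_upwards [hM, hN] with k h1 h2
      exact (norm_sub_le _ _).trans (add_le_add h1 h2))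
  simpa [sub_eq_zero] using hD

theorem orbit_ne_one {z q : ℂ} (hz : ∀ k : ℕ, 1 ≤ k → z * q ^ k ≠ 1) (i k : ℕ) (hk : 1 ≤ k) :
    z * q ^ i * q ^ k ≠ 1 := by
  rw [mul_assoc, ← pow_add]
  exact hz _ (by omega)

theorem summable_half (C : ℝ) : Summable fun n : ℕ => C * (1 / 2 : ℝ) ^ n :=
  (summable_geometric_of_lt_one (by norm_num) (by norm_num)).mul_left C

theorem tsum_omegaTerm_eq {z q : ℂ} (hq : ‖q‖ < 1) (hz : ∀ k : ℕ, 1 ≤ k → z * q ^ k ≠ 1) :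
    ∑' n, omegaTerm z q n = ∑' n, omegaMockTerm z q n := by
  refine tsum_eq_of_functional (F := fun z => omegaTerm z q) (G := fun z => omegaMockTerm z q)
    hq hz ((summable_geometric_of_lt_one (norm_nonneg q) hq).mul_left 2) (summable_half _)
    (fun k => tsum_omegaTerm_functional hq (orbit_ne_one hz _))
    (fun k => tsum_omegaMockTerm_functional hq (orbit_ne_one hz _)) ?_
    (exists_norm_omegaMockTerm_le hq)
  obtain ⟨δ, h0, h⟩ := exists_norm_omegaTerm_le hq
  refine ⟨δ, h0, fun w n hw => h w n ?_⟩
  have := norm_mul_pow_le w hq (Nat.zero_le (n + 1))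
  rw [pow_zero, mul_one] at this
  exact this.trans_lt hw

theorem omegaOriginalTerm_succ (z q : ℂ) (n : ℕ) :
    omegaOriginalTerm z q (n + 1) = q * omegaTerm z q n := by
  unfold omegaOriginalTerm omegaTerm
  rw [show 2 * (n + 1) + 2 = 2 * n + 4 by ring, pow_succ' q n, mul_div_assoc]

theorem omegaOriginalMockTerm_eq (z q : ℂ) (n : ℕ) :
    omegaOriginalMockTerm z q n = q * omegaMockTerm z q n := by
  unfold omegaOriginalMockTerm omegaMockTerm
  ring

/-! ### The second identity -/

theorem nuTerm_eq (z q : ℂ) (n : ℕ) : nuTerm z q n = q ^ n * mixedProd (-z) q n := by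
  unfold nuTerm mixedProd
  rw [neg_mul, neg_mul, mul_assoc]

theorem exists_norm_nuTerm_le {q : ℂ} (hq : ‖q‖ < 1) :
    ∃ δ > 0, ∀ (z : ℂ) (n : ℕ), ‖z * q ^ (n + 1)‖ < δ → ‖nuTerm z q n‖ ≤ 2 * ‖q‖ ^ n := by
  obtain ⟨δ, h0, h⟩ := exists_norm_bound q
  refine ⟨δ, h0, fun z n hz => ?_⟩
  have h1 := (norm_mixedProd_sub_one_le (-z) hq n).trans (h _ (by rwa [neg_mul, norm_neg]))
  have h2 := norm_sub_norm_le (mixedProd (-z) q n) 1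
  rw [norm_one] at h2
  rw [nuTerm_eq, norm_mul, norm_pow, mul_comm]
  exact mul_le_mul_of_nonneg_right (by linarith) (pow_nonneg (norm_nonneg q) n)

theorem summable_nuTerm (z : ℂ) {q : ℂ} (hq : ‖q‖ < 1) : Summable (nuTerm z q) := by
  obtain ⟨δ, h0, h⟩ := exists_norm_nuTerm_le hq
  have h1 := (tendsto_mul_pow_zero z hq (tendsto_add_atTop_nat 1)).norm
  rw [norm_zero] at h1
  refine Summable.of_norm_bounded_eventually_nat
    ((summable_geometric_of_lt_one (norm_nonneg q) hq).mul_left 2) ?_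
  filter_upwards [h1.eventually (gt_mem_nhds h0)] with n hn
  exact h z n hn

/-- Both M_{n+1} and M_{n+2} at z are explicit multiples of M_n at zq². Hence the (n+1)-st term at z
minus (q + zq²) times the n-th term at zq² is M_{n+2} - M_{n+1}. -/
theorem tsum_nuTerm_functional (z : ℂ) {q : ℂ} (hq : ‖q‖ < 1) :
    ∑' n, nuTerm z q n = 1 + (q + z * q ^ 2) * ∑' n, nuTerm (z * q ^ 2) q n := by
  have hS := (summable_nuTerm z hq).hasSum
  have hS' := (summable_nuTerm (z * q ^ 2) hq).hasSum
  have h2 := ((hasSum_nat_add_iff' 1).2 hS).sub (hS'.mul_left (q + z * q ^ 2))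
  have h3 := hasSum_telescope h2.summable (E := fun n => mixedProd (-z) q (n + 1)) (fun n => by
    rw [mixedProd_succ (-z) q n, mixedProd_add_two (-z) hq n, nuTerm_eq, nuTerm_eq,
      mixedProd_succ, ← neg_mul]
    ring) ((tendsto_mixedProd (-z) hq).comp (tendsto_add_atTop_nat 1))
  have h4 := h2.unique h3
  simp only [zero_add, mixedProd_one _ hq, Finset.sum_range_one, nuTerm_eq, pow_zero,
    one_mul] at h4
  simp only [nuTerm_eq]
  linear_combination h4

theorem nuMockTerm_succ (z q : ℂ) (n : ℕ) : nuMockTerm z q (n + 1) =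
    z * q ^ (2 * n + 2) / (1 - q ^ (2 * n + 3)) * nuMockTerm z q n := by
  unfold nuMockTerm
  rw [qPoch_succ q, div_mul_div_comm]
  congr 1 <;> ring

theorem summable_nuMockTerm (z : ℂ) {q : ℂ} (hq : ‖q‖ < 1) : Summable (nuMockTerm z q) := by
  refine summable_of_ratio_tendsto (r := 0) (by simp) ?_ (nuMockTerm_succ z q)
  have h1 := tendsto_mul_pow_zero z hq (g := fun n => 2 * n + 2)
    (tendsto_atTop_mono (fun n => by dsimp; omega) tendsto_id)
  have h3 := tendsto_mul_pow_zero 1 hq (g := fun n => 2 * n + 3)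
    (tendsto_atTop_mono (fun n => by dsimp; omega) tendsto_id)
  simp only [one_mul] at h3
  exact tendsto_div_of_tendsto_one h1 (by simpa using h3.const_sub 1)

/-- Termwise, t_{n+1}(z) - zq² t_n(zq²) = q t_{n+1}(zq²): the two terms on the left differ by the
factor 1 - q^(2n+3). The missing terms at index 0 contribute (1 - q)/(1 - q) = 1. -/
theorem tsum_nuMockTerm_functional (z : ℂ) {q : ℂ} (hq : ‖q‖ < 1) :
    ∑' n, nuMockTerm z q n = 1 + (q + z * q ^ 2) * ∑' n, nuMockTerm (z * q ^ 2) q n := by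
  have hS := (summable_nuMockTerm z hq).hasSum
  have hS' := (summable_nuMockTerm (z * q ^ 2) hq).hasSum
  have hq1 : ∀ k : ℕ, 1 - q ^ (k + 1) ≠ 0 := fun k =>
    sub_ne_zero.2 (pow_ne_one_of_norm_lt_one hq (by omega)).symm
  have h2 := ((hasSum_nat_add_iff' 1).2 hS).sub (hS'.mul_left (z * q ^ 2))
  have h3 : HasSum (fun n => q * nuMockTerm (z * q ^ 2) q (n + 1))
      (q * ∑' n, nuMockTerm (z * q ^ 2) q n - q * nuMockTerm (z * q ^ 2) q 0) := by
    simpa using (hasSum_nat_add_iff' 1).2 (hS'.mul_left q)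
  have h4 := h2.unique (h3.congr_fun fun n => by
    unfold nuMockTerm
    rw [qPoch_succ q _ (n + 1)]
    have e1 : q * (q ^ 2) ^ (n + 1) = q ^ (2 * n + 2 + 1) := by ring
    rw [e1]
    have := hq1 (2 * n + 2)
    have := qPoch_self_sq_ne_zero hq (n + 1)
    field_simp
    ring)
  have h5 : 1 - q ≠ 0 := by simpa using hq1 0
  have h6 : ∀ w, nuMockTerm w q 0 = (1 - q)⁻¹ := fun w => by
    simp [nuMockTerm, qPoch_succ, qPoch_zero]
  rw [Finset.sum_range_one, h6, h6] at h4
  have h7 : (1 - q) * (1 - q)⁻¹ = 1 := mul_inv_cancel₀ h5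
  linear_combination h4 + h7

theorem exists_norm_nuMockTerm_le {q : ℂ} (hq : ‖q‖ < 1) :
    ∃ δ > 0, ∀ (z : ℂ) (n : ℕ), ‖z‖ < δ →
      ‖nuMockTerm z q n‖ ≤ 1 / (1 - ‖q‖) * (1 / 2) ^ n := by
  have h01 : 0 < 1 - ‖q‖ := by linarith
  refine ⟨(1 - ‖q‖) / 2, by linarith, fun z n hz => ?_⟩
  have h2 := pow_le_norm_qPoch hq (n + 1)
  unfold nuMockTerm
  rw [norm_div, norm_mul, norm_pow, norm_pow]
  calc _ ≤ ((1 - ‖q‖) / 2) ^ n * 1 / (1 - ‖q‖) ^ (n + 1) := by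
        gcongr
        exact pow_le_one₀ (norm_nonneg _) hq.le
    _ = _ := by
        rw [div_pow, pow_succ, one_div_pow]
        field_simp

theorem tsum_nuTerm_eq (z : ℂ) {q : ℂ} (hq : ‖q‖ < 1) :
    ∑' n, nuTerm z q n = ∑' n, nuMockTerm z q n := by
  obtain ⟨M, hM⟩ := exists_eventually_norm_tsum_le (F := fun z => nuTerm z q) (z := z) hq
    ((summable_geometric_of_lt_one (norm_nonneg q) hq).mul_left 2) (by
      obtain ⟨δ, h0, h⟩ := exists_norm_nuTerm_le hq
      refine ⟨δ, h0, fun w n hw => h w n ?_⟩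
      have := norm_mul_pow_le w hq (Nat.zero_le (n + 1))
      rw [pow_zero, mul_one] at this
      exact this.trans_lt hw)
  obtain ⟨N, hN⟩ := exists_eventually_norm_tsum_le (F := fun z => nuMockTerm z q) (z := z) hq
    (summable_half _) (exists_norm_nuMockTerm_le hq)
  -- The coefficient involves no division here, so that no z has to be excluded.
  have hc : Tendsto (fun k : ℕ => q + z * q ^ (2 * k + 2)) atTop (𝓝 q) := by
    simpa using (tendsto_mul_pow_zero z hq (g := fun k => 2 * k + 2)
      (tendsto_atTop_mono (fun n => by dsimp; omega) tendsto_id)).const_add q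
  have hD := eq_zero_of_contracting
    (D := fun k => ∑' n, nuTerm (z * q ^ (2 * k)) q n - ∑' n, nuMockTerm (z * q ^ (2 * k)) q n)
    hq hc (fun k => by
      have h1 := tsum_nuTerm_functional (z * q ^ (2 * k)) hq
      have h2 := tsum_nuMockTerm_functional (z * q ^ (2 * k)) hq
      rw [show z * q ^ (2 * k) * q ^ 2 = z * q ^ (2 * (k + 1)) by ring] at h1 h2
      rw [show 2 * k + 2 = 2 * (k + 1) by ring]
      linear_combination h1 - h2) (M := M + N) (by
      filter_upwards [hM, hN] with k h1 h2
      exact (norm_sub_le _ _).trans (add_le_add h1 h2))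
  simpa [sub_eq_zero] using hD

/-! ### Destructive and constructive steps -/

/-- A class `P` of lists with a destructive operator `f` and a constructive operator `build`
inverse to it. A constructive step either makes the list longer by one and increases the size
by `e ℓ`, where `ℓ` is the length, or keeps the length `ℓ ≥ 2` and increases the size by
`2 * ℓ - 1`. -/
structure StepSystem (e : ℕ → ℕ) (P : Set (List ℕ)) (f : List ℕ → List ℕ) (size : List ℕ → ℕ)
    (build : ℕ → List ℕ → List ℕ) (start : ℕ → List ℕ) : Prop where
  ne_nil : ∀ l ∈ P, l ≠ []
  start_mem : ∀ n, start n ∈ P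
  length_start : ∀ n, (start n).length = 1
  size_start : ∀ n, size (start n) = n
  eq_start : ∀ l ∈ P, l.length = 1 → l = start (size l)
  destruct : ∀ l ∈ P, 2 ≤ l.length → f l ∈ P ∧ build (size l - size (f l)) (f l) = l ∧
    ((l.length = (f l).length + 1 ∧ size l = size (f l) + e (f l).length) ∨
      (l.length = (f l).length ∧ size l = size (f l) + (2 * (f l).length - 1)))
  row : ∀ l ∈ P, build (e l.length) l ∈ P ∧ f (build (e l.length) l) = l ∧
    (build (e l.length) l).length = l.length + 1 ∧
    size (build (e l.length) l) = size l + e l.length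
  col : ∀ l ∈ P, 2 ≤ l.length → build (2 * l.length - 1) l ∈ P ∧
    f (build (2 * l.length - 1) l) = l ∧ (build (2 * l.length - 1) l).length = l.length ∧
    size (build (2 * l.length - 1) l) = size l + (2 * l.length - 1)

/-- Decompose a list by `f`, and rebuild from the size differences by `build` and `start`. -/
noncomputable def transform (f : List ℕ → List ℕ) (size : List ℕ → ℕ)
    (build : ℕ → List ℕ → List ℕ) (start : ℕ → List ℕ) (l : List ℕ) : List ℕ :=
  (diffSeq f size l).foldr build (start (size (terminal f l)))

theorem stopTime_of_length_eq_one {f : List ℕ → List ℕ} {l : List ℕ} (h : l.length = 1) :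
    stopTime f l = 0 := by
  unfold stopTime
  exact Nat.sInf_eq_zero.2 (Or.inl h)

/-- The infimum of the empty set is 0, so a stopping index must be known to exist. Index 0 is
excluded by the length, and the two minima differ by one. -/
theorem stopTime_succ {f : List ℕ → List ℕ} {l : List ℕ} (h : l.length ≠ 1)
    (hex : ∃ i : ℕ, (f^[i] (f l)).length = 1) : stopTime f l = stopTime f (f l) + 1 := by
  have hne : {i | (f^[i] (f l)).length = 1}.Nonempty := hex
  have h1 : (f^[stopTime f (f l)] (f l)).length = 1 := Nat.sInf_mem hne
  apply le_antisymm
  · exact Nat.sInf_le (show (f^[stopTime f (f l) + 1] l).length = 1 from h1)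
  · have hne' : {i | (f^[i] l).length = 1}.Nonempty := ⟨stopTime f (f l) + 1, h1⟩
    have h2 : (f^[stopTime f l] l).length = 1 := Nat.sInf_mem hne'
    rcases hk : stopTime f l with _ | k
    · rw [hk] at h2
      exact absurd h2 h
    · rw [hk] at h2
      exact Nat.succ_le_succ (Nat.sInf_le (show (f^[k] (f l)).length = 1 from h2))

theorem transform_of_length_eq_one {f : List ℕ → List ℕ} {size : List ℕ → ℕ}
    {build : ℕ → List ℕ → List ℕ} {start : ℕ → List ℕ} {l : List ℕ} (h : l.length = 1) :
    transform f size build start l = start (size l) := by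
  simp [transform, diffSeq, terminal, stopTime_of_length_eq_one h]

/-- The right fold puts the first recorded difference outermost: what is destroyed first is rebuilt
last. -/
theorem transform_succ {f : List ℕ → List ℕ} {size : List ℕ → ℕ}
    {build : ℕ → List ℕ → List ℕ} {start : ℕ → List ℕ} {l : List ℕ} (h : l.length ≠ 1)
    (hex : ∃ i : ℕ, (f^[i] (f l)).length = 1) :
    transform f size build start l =
      build (size l - size (f l)) (transform f size build start (f l)) := by
  simp only [transform, diffSeq, terminal, stopTime_succ h hex, List.range_succ_eq_map,
    List.map_cons, List.map_map, List.foldr_cons]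
  rfl

/-- The members of `P` of length `m + 1` and size `n`. -/
def sizeClass (P : Set (List ℕ)) (size : List ℕ → ℕ) (m n : ℕ) : Set (List ℕ) :=
  {l ∈ P | l.length = m + 1 ∧ size l = n}

namespace StepSystem

variable {e : ℕ → ℕ} {P P' : Set (List ℕ)} {f f' : List ℕ → List ℕ} {size size' : List ℕ → ℕ}
  {build build' : ℕ → List ℕ → List ℕ} {start start' : ℕ → List ℕ}

theorem length_pos (S : StepSystem e P f size build start) {l : List ℕ} (hl : l ∈ P) :
    1 ≤ l.length :=
  List.length_pos_iff.2 (S.ne_nil l hl)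

theorem size_lt (S : StepSystem e P f size build start) (he : ∀ k, 1 ≤ k → 1 ≤ e k)
    {l : List ℕ} (hl : l ∈ P) (h2 : 2 ≤ l.length) : size (f l) < size l := by
  obtain ⟨h, -, ⟨h3, h4⟩ | ⟨h3, h4⟩⟩ := S.destruct l hl h2
  · have := he _ (S.length_pos h)
    omega
  · omega

/-- A destructive step strictly lowers the size, since both possible increments are positive. -/
theorem induction_on (S : StepSystem e P f size build start) (he : ∀ k, 1 ≤ k → 1 ≤ e k)
    {motive : (l : List ℕ) → l ∈ P → Prop}
    (one : ∀ (l : List ℕ) (hl : l ∈ P), l.length = 1 → motive l hl)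
    (step : ∀ (l : List ℕ) (hl : l ∈ P) (h : 2 ≤ l.length),
      motive (f l) (S.destruct l hl h).1 → motive l hl) (l : List ℕ) (hl : l ∈ P) :
    motive l hl := by
  induction hn : size l using Nat.strong_induction_on generalizing l with
  | _ n ih =>
    rcases (S.length_pos hl).eq_or_lt with h | h
    · exact one l hl h.symm
    · subst hn
      exact step l hl h (ih _ (S.size_lt he hl h) _ (S.destruct l hl h).1 rfl)

theorem exists_length_eq_one (S : StepSystem e P f size build start) (he : ∀ k, 1 ≤ k → 1 ≤ e k)
    (l : List ℕ) (hl : l ∈ P) : ∃ i : ℕ, (f^[i] l).length = 1 := by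
  induction l, hl using S.induction_on he with
  | one l hl h => exact ⟨0, h⟩
  | step l hl h ih =>
    obtain ⟨i, hi⟩ := ih
    exact ⟨i + 1, hi⟩

/-- By induction the images have the same lengths and sizes at every stage. An increment depends
only on the kind of step and the length, so each difference recorded in one system is a legal
increment in the other, and playing it back records the same difference again. -/
theorem transform_spec (S : StepSystem e P f size build start)
    (S' : StepSystem e P' f' size' build' start') (he : ∀ k, 1 ≤ k → 1 ≤ e k)
    (l : List ℕ) (hl : l ∈ P) :
    transform f size build' start' l ∈ P' ∧
      (transform f size build' start' l).length = l.length ∧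
      size' (transform f size build' start' l) = size l ∧
      transform f' size' build start (transform f size build' start' l) = l := by
  induction l, hl using S.induction_on he with
  | one l hl h =>
    rw [transform_of_length_eq_one h]
    refine ⟨S'.start_mem _, by rw [S'.length_start, h], S'.size_start _, ?_⟩
    rw [transform_of_length_eq_one (S'.length_start _), S'.size_start]
    exact (S.eq_start l hl h).symm
  | step l hl h ih =>
    obtain ⟨h1, h2, h3, h4⟩ := ih
    obtain ⟨hf, hb, hd⟩ := S.destruct l hl h
    rw [transform_succ (by omega) (S.exists_length_eq_one he _ hf)]
    set p := transform f size build' start' (f l) with hp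
    -- `p` has the length and the size of `f l`, so a row step there corresponds to a row step here,
    -- and a column step to a column step.
    obtain ⟨k1, k2, k3, k4⟩ : build' (size l - size (f l)) p ∈ P' ∧
        f' (build' (size l - size (f l)) p) = p ∧
        (build' (size l - size (f l)) p).length = l.length ∧
        size' (build' (size l - size (f l)) p) = size l := by
      rcases hd with ⟨h5, h6⟩ | ⟨h5, h6⟩
      · have := S'.row p h1
        rw [h2, h3] at this
        rw [show size l - size (f l) = e (f l).length by omega, h5, h6]
        exact this
      · have := S'.col p h1 (by omega)
        rw [h2, h3] at this
        rw [show size l - size (f l) = 2 * (f l).length - 1 by omega, h5, h6]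
        exact this
    refine ⟨k1, k3, k4, ?_⟩
    rw [transform_succ (by omega) (by rw [k2]; exact S'.exists_length_eq_one he _ h1), k2, k4, h3, h4, hb]

theorem mapsTo_transform (S : StepSystem e P f size build start)
    (S' : StepSystem e P' f' size' build' start') (he : ∀ k, 1 ≤ k → 1 ≤ e k) (m n : ℕ) :
    Set.MapsTo (transform f size build' start') (sizeClass P size m n)
      (sizeClass P' size' m n) := by
  rintro l ⟨hl, h1, h2⟩
  obtain ⟨k1, k2, k3, -⟩ := S.transform_spec S' he l hl
  exact ⟨k1, k2.trans h1, k3.trans h2⟩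

theorem invOn_transform (S : StepSystem e P f size build start)
    (S' : StepSystem e P' f' size' build' start') (he : ∀ k, 1 ≤ k → 1 ≤ e k) (m n : ℕ) :
    Set.InvOn (transform f' size' build start) (transform f size build' start')
      (sizeClass P size m n) (sizeClass P' size' m n) :=
  ⟨fun l hl => (S.transform_spec S' he l hl.1).2.2.2,
    fun l hl => (S'.transform_spec S he l hl.1).2.2.2⟩

theorem bijOn_transform (S : StepSystem e P f size build start)
    (S' : StepSystem e P' f' size' build' start') (he : ∀ k, 1 ≤ k → 1 ≤ e k) (m n : ℕ) :
    Set.BijOn (transform f size build' start') (sizeClass P size m n) (sizeClass P' size' m n) :=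
  (S.invOn_transform S' he m n).bijOn (S.mapsTo_transform S' he m n) (S'.mapsTo_transform S he m n)

/-! ### Counting -/

theorem sizeClass_zero (S : StepSystem e P f size build start) (n : ℕ) :
    sizeClass P size 0 n = {start n} := by
  ext l
  constructor
  · rintro ⟨hl, h1, h2⟩
    rw [Set.mem_singleton_iff, ← h2]
    exact S.eq_start l hl h1
  · rintro rfl
    exact ⟨S.start_mem n, S.length_start n, S.size_start n⟩

/-- The members of length `m + 2` and size `n` that arise by adding a row. -/
def rowClass (P : Set (List ℕ)) (size : List ℕ → ℕ) (e : ℕ → ℕ) (m n : ℕ) : Set (List ℕ) :=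
  if e (m + 1) ≤ n then sizeClass P size m (n - e (m + 1)) else ∅

/-- The members of length `m + 2` and size `n` that arise by adding columns. -/
def colClass (P : Set (List ℕ)) (size : List ℕ → ℕ) (m n : ℕ) : Set (List ℕ) :=
  if 2 * m + 3 ≤ n then sizeClass P size (m + 1) (n - (2 * m + 3)) else ∅

theorem mem_rowClass {m n : ℕ} {l : List ℕ} : l ∈ rowClass P size e m n ↔
    l ∈ P ∧ l.length = m + 1 ∧ size l + e (m + 1) = n := by
  unfold rowClass sizeClass
  split_ifs with h
  · simp only [Set.mem_ofPred_eq]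
    refine and_congr_right fun _ => and_congr_right fun _ => ?_
    omega
  · simp only [Set.mem_empty_iff_false, false_iff]
    rintro ⟨-, -, h'⟩
    omega

theorem mem_colClass {m n : ℕ} {l : List ℕ} : l ∈ colClass P size m n ↔
    l ∈ P ∧ l.length = m + 2 ∧ size l + (2 * m + 3) = n := by
  unfold colClass sizeClass
  split_ifs with h
  · simp only [Set.mem_ofPred_eq]
    refine and_congr_right fun _ => and_congr_right fun _ => ?_
    omega
  · simp only [Set.mem_empty_iff_false, false_iff]
    rintro ⟨-, -, h'⟩
    omega

/-- The last construction step was a row step from length m + 1 or a column step from length m + 2,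
the latter adding 2(m+2) - 1 = 2m + 3. -/
theorem sizeClass_succ (S : StepSystem e P f size build start) (m n : ℕ) :
    sizeClass P size (m + 1) n = build (e (m + 1)) '' rowClass P size e m n ∪
      build (2 * m + 3) '' colClass P size m n := by
  ext l
  constructor
  · rintro ⟨hl, h1, h2⟩
    obtain ⟨hf, hb, ⟨h3, h4⟩ | ⟨h3, h4⟩⟩ := S.destruct l hl (by omega)
    · left
      have h5 : (f l).length = m + 1 := by omega
      rw [h5] at h4
      refine ⟨f l, mem_rowClass.2 ⟨hf, h5, by omega⟩, ?_⟩
      rwa [h4, Nat.add_sub_cancel_left] at hb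
    · right
      have h5 : (f l).length = m + 2 := by omega
      rw [h5, show 2 * (m + 2) - 1 = 2 * m + 3 by omega] at h4
      refine ⟨f l, mem_colClass.2 ⟨hf, h5, by omega⟩, ?_⟩
      rwa [h4, Nat.add_sub_cancel_left] at hb
  · rintro (⟨p, hp, rfl⟩ | ⟨p, hp, rfl⟩)
    · obtain ⟨h1, h2, h3⟩ := mem_rowClass.1 hp
      have := S.row p h1
      rw [h2] at this
      exact ⟨this.1, this.2.2.1, this.2.2.2.trans h3⟩
    · obtain ⟨h1, h2, h3⟩ := mem_colClass.1 hp
      have := S.col p h1 (by omega)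
      rw [h2, show 2 * (m + 2) - 1 = 2 * m + 3 by omega] at this
      exact ⟨this.1, this.2.2.1, this.2.2.2.trans h3⟩

/-- Undoing a row step lowers m, and undoing a column step lowers n for the same m; hence the nested
induction. -/
theorem finite_sizeClass (S : StepSystem e P f size build start) (m n : ℕ) :
    (sizeClass P size m n).Finite := by
  induction m generalizing n with
  | zero => rw [S.sizeClass_zero]; exact Set.finite_singleton _
  | succ m ihm =>
    induction n using Nat.strong_induction_on with
    | _ n ihn =>
      rw [S.sizeClass_succ]
      refine Set.Finite.union (Set.Finite.image _ ?_) (Set.Finite.image _ ?_)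
      · unfold rowClass
        split_ifs
        · exact ihm _
        · exact Set.finite_empty
      · unfold colClass
        split_ifs
        · exact ihn _ (by omega)
        · exact Set.finite_empty

theorem ncard_sizeClass_zero (S : StepSystem e P f size build start) (n : ℕ) :
    (sizeClass P size 0 n).ncard = 1 := by
  rw [S.sizeClass_zero, Set.ncard_singleton]

/-- The destructive operator inverts both kinds of step, so both maps are injective. A common value
would have a single preimage of two different lengths, so the images are disjoint. -/
theorem ncard_sizeClass_succ (S : StepSystem e P f size build start) (m n : ℕ) :
    (sizeClass P size (m + 1) n).ncard =
      (if e (m + 1) ≤ n then (sizeClass P size m (n - e (m + 1))).ncard else 0) +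
      (if 2 * m + 3 ≤ n then (sizeClass P size (m + 1) (n - (2 * m + 3))).ncard else 0) := by
  have hr : Set.LeftInvOn f (build (e (m + 1))) (rowClass P size e m n) := by
    intro p hp
    obtain ⟨h1, h2, -⟩ := mem_rowClass.1 hp
    have := (S.row p h1).2.1
    rwa [h2] at this
  have hc : Set.LeftInvOn f (build (2 * m + 3)) (colClass P size m n) := by
    intro p hp
    obtain ⟨h1, h2, -⟩ := mem_colClass.1 hp
    have := (S.col p h1 (by omega)).2.1
    rwa [h2, show 2 * (m + 2) - 1 = 2 * m + 3 by omega] at this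
  have hfin := S.finite_sizeClass (m + 1) n
  rw [S.sizeClass_succ] at hfin ⊢
  rw [Set.ncard_union_eq ?_ (hfin.subset Set.subset_union_left)
    (hfin.subset Set.subset_union_right), hr.injOn.ncard_image, hc.injOn.ncard_image]
  · unfold rowClass colClass
    split_ifs <;> simp
  · rw [Set.disjoint_left]
    rintro _ ⟨p, hp, rfl⟩ ⟨p', hp', h⟩
    have h1 : p' = p := by rw [← hr hp, ← hc hp', h]
    subst h1
    have h2 := (mem_rowClass.1 hp).2.1
    have h3 := (mem_colClass.1 hp').2.1
    omega

end StepSystem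

/-! ### Lists -/

@[simp] theorem lastPart_concat (l : List ℕ) (a : ℕ) : lastPart (l ++ [a]) = a := by
  simp [lastPart]

@[simp] theorem lastPart_append_pair (l : List ℕ) (a b : ℕ) : lastPart (l ++ [a, b]) = b := by
  rw [show l ++ [a, b] = l ++ [a] ++ [b] by simp, lastPart_concat]

@[simp] theorem dropLast_append_pair (l : List ℕ) (a b : ℕ) :
    (l ++ [a, b]).dropLast = l ++ [a] := by
  rw [show l ++ [a, b] = l ++ [a] ++ [b] by simp, List.dropLast_concat]

@[simp] theorem penultimatePart_append_pair (l : List ℕ) (a b : ℕ) :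
    penultimatePart (l ++ [a, b]) = a := by
  simp [penultimatePart]

theorem exists_eq_concat {l : List ℕ} (h : l ≠ []) : ∃ q a, l = q ++ [a] :=
  ⟨_, _, (List.dropLast_append_getLast h).symm⟩

theorem exists_eq_append_pair {l : List ℕ} (h : 2 ≤ l.length) : ∃ p b a, l = p ++ [b, a] := by
  obtain ⟨q, a, rfl⟩ := exists_eq_concat (l := l) (by rintro rfl; simp at h)
  obtain ⟨p, b, rfl⟩ := exists_eq_concat (l := q) (by rintro rfl; simp at h)
  exact ⟨p, b, a, by simp⟩

theorem sortDesc_eq {l s : List ℕ} (h : l.Perm s) (hs : s.Pairwise (· ≥ ·)) : sortDesc l = s :=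
  ((List.perm_insertionSort _ l).trans h).eq_of_pairwise' (List.pairwise_insertionSort _ l) hs

theorem sortDesc_perm (l : List ℕ) : (sortDesc l).Perm l := List.perm_insertionSort _ l

theorem pairwise_sortDesc (l : List ℕ) : (sortDesc l).Pairwise (· ≥ ·) :=
  List.pairwise_insertionSort _ l

theorem pairwise_concat {r : ℕ → ℕ → Prop} {q : List ℕ} {a : ℕ} :
    (q ++ [a]).Pairwise r ↔ q.Pairwise r ∧ ∀ x ∈ q, r x a := by
  simp [List.pairwise_append]

/-- Writing a list as a shifted one avoids truncated subtraction: removing the shift is then an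
exact inverse. -/
theorem exists_eq_map_add {l : List ℕ} {c : ℕ} (h : ∀ x ∈ l, c ≤ x) :
    ∃ t : List ℕ, l = t.map (· + c) := by
  refine ⟨l.map (· - c), ?_⟩
  rw [List.map_map]
  refine (List.map_id'' (fun x => rfl) l).symm.trans (List.map_congr_left fun x hx => ?_)
  have := h x hx
  simp only [Function.comp_apply]
  omega

theorem map_add_map_sub (l : List ℕ) (c : ℕ) : (l.map (· + c)).map (· - c) = l := by
  simp [List.map_map, Function.comp_def]

theorem sum_map_add_const (l : List ℕ) (c : ℕ) :
    (l.map (· + c)).sum = l.sum + c * l.length := by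
  induction l with
  | nil => simp
  | cons x t ih => simp only [List.map_cons, List.sum_cons, ih, List.length_cons]; ring

theorem le_foldr_max {l : List ℕ} {a : ℕ} (h : a ∈ l) : a ≤ l.foldr max 0 := by
  induction l with
  | nil => simp at h
  | cons x t ih =>
    rw [List.foldr_cons]
    rcases List.mem_cons.1 h with rfl | h
    · exact le_max_left _ _
    · exact (ih h).trans (le_max_right _ _)

theorem foldr_max_mem {l : List ℕ} (h : l ≠ []) : l.foldr max 0 ∈ l := by
  induction l with
  | nil => exact absurd rfl h
  | cons x t ih =>
    rw [List.foldr_cons]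
    rcases eq_or_ne t [] with rfl | h0
    · simp
    · rcases max_choice x (t.foldr max 0) with h1 | h1
      · rw [h1]; exact List.mem_cons_self
      · rw [h1]; exact List.mem_cons_of_mem _ (ih h0)

theorem le_largestOdd {l : List ℕ} {a : ℕ} (h : a ∈ l) (ha : Odd a) : a ≤ largestOdd l :=
  le_foldr_max (List.mem_filter.2 ⟨h, by simpa using Nat.odd_iff.1 ha⟩)

theorem largestOdd_mem {l : List ℕ} (h : ∃ a ∈ l, Odd a) :
    largestOdd l ∈ l ∧ Odd (largestOdd l) := by
  obtain ⟨a, h1, h2⟩ := h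
  have h3 : largestOdd l ∈ l.filter fun a => a % 2 = 1 := foldr_max_mem
    (List.ne_nil_of_mem (List.mem_filter.2 ⟨h1, by simpa using Nat.odd_iff.1 h2⟩))
  obtain ⟨h4, h5⟩ := List.mem_filter.1 h3
  exact ⟨h4, Nat.odd_iff.2 (by simpa using h5)⟩

theorem largestOdd_eq {l : List ℕ} {c : ℕ} (h : c ∈ l) (hc : Odd c)
    (hle : ∀ a ∈ l, Odd a → a ≤ c) : largestOdd l = c := by
  have h1 := largestOdd_mem ⟨c, h, hc⟩
  exact le_antisymm (hle _ h1.1 h1.2) (le_largestOdd h hc)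

/-- Splitting undoes joining. -/
theorem phiCPlus_eq {s p : List ℕ} {k : ℕ} (hs : s.Perm (p ++ [2 * k + 1]))
    (hle : ∀ x ∈ p, Odd x → x ≤ 2 * k + 1) (hp : (p ++ [k + 1, k]).Pairwise (· ≥ ·)) :
    phiCPlus s = p ++ [k + 1, k] := by
  have h1 : largestOdd s = 2 * k + 1 := by
    refine largestOdd_eq (hs.mem_iff.2 (by simp)) (odd_two_mul_add_one k) fun x hx hx' => ?_
    rcases List.mem_append.1 (hs.mem_iff.1 hx) with h | h
    · exact hle x h hx'
    · exact (List.mem_singleton.1 h).le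
  unfold phiCPlus
  rw [h1, show (2 * k + 1 + 1) / 2 = k + 1 by omega, show (2 * k + 1 - 1) / 2 = k by omega]
  refine sortDesc_eq (List.Perm.append_right _ ?_) hp
  have h2 := (hs.trans List.perm_append_comm).erase (2 * k + 1)
  simpa using h2

/-- Joining undoes splitting. -/
theorem phiCMinus_eq {s p : List ℕ} {k : ℕ} (hs : s.Perm (p ++ [2 * k + 1]))
    (hp : s.Pairwise (· ≥ ·)) : phiCMinus (p ++ [k + 1, k]) = s := by
  unfold phiCMinus
  simp only [dropLast_append_pair, List.dropLast_concat, penultimatePart_append_pair,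
    lastPart_append_pair]
  rw [show k + 1 + k = 2 * k + 1 by ring]
  exact sortDesc_eq hs.symm hp

/-- A list with an odd part contains a largest odd part. -/
theorem exists_erase_largestOdd {s : List ℕ} (h : ∃ a ∈ s, Odd a) :
    ∃ (p : List ℕ) (k : ℕ), s.Perm (p ++ [2 * k + 1]) ∧ p.Sublist s ∧
      ∀ x ∈ s, Odd x → x ≤ 2 * k + 1 := by
  obtain ⟨h1, k, hk⟩ := largestOdd_mem h
  refine ⟨s.erase (largestOdd s), k, ?_, List.erase_sublist, fun x hx hx' => ?_⟩
  · rw [← hk]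
    exact (List.perm_cons_erase h1).trans (List.perm_append_comm (l₁ := [_]))
  · rw [← hk]
    exact le_largestOdd hx hx'

/-! ### Partitions with a unique smallest part -/

/-- The parity condition on the last part is automatic, since a ≤ 2a + 1. -/
theorem concat_mem_POmega {q : List ℕ} {a : ℕ} : q ++ [a] ∈ POmega ↔
    q.Pairwise (· ≥ ·) ∧ (∀ x ∈ q, a < x) ∧ ∀ x ∈ q, Odd x → x ≤ 2 * a + 1 := by
  change (_ ∧ _ ∧ _ ∧ _) ↔ _
  rw [pairwise_concat, lastPart_concat, List.dropLast_concat]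
  constructor
  · rintro ⟨-, ⟨h1, -⟩, h2, h3⟩
    exact ⟨h1, h2, fun x hx => h3 x (List.mem_append_left _ hx)⟩
  · rintro ⟨h1, h2, h3⟩
    refine ⟨by simp, ⟨h1, fun x hx => (h2 x hx).le⟩, h2, fun x hx => ?_⟩
    rcases List.mem_append.1 hx with h | h
    · exact h3 x h
    · rw [List.mem_singleton.1 h]
      omega

theorem phiPlus_concat {q : List ℕ} {a : ℕ} (h1 : q.Pairwise (· ≥ ·)) (h2 : ∀ x ∈ q, a < x) :
    phiPlus (q ++ [a]) = q ++ [a + 1] := by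
  unfold phiPlus
  rw [List.dropLast_concat, lastPart_concat]
  exact sortDesc_eq (List.Perm.refl _) (pairwise_concat.2 ⟨h1, h2⟩)

theorem phiMinus_concat (q : List ℕ) (a : ℕ) : phiMinus (q ++ [a]) = q ++ [a - 1] := by
  unfold phiMinus
  rw [List.dropLast_concat, lastPart_concat]

theorem phiOPlus_concat (q : List ℕ) (a : ℕ) :
    phiOPlus (q ++ [a]) = q.map (· + 2) ++ [a + 1] := by
  unfold phiOPlus
  rw [List.dropLast_concat, lastPart_concat]

theorem phiOMinus_concat {q : List ℕ} {a : ℕ} (h : (q ++ [a]).Pairwise (· ≥ ·)) :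
    phiOMinus (q.map (· + 2) ++ [a + 1]) = q ++ [a] := by
  unfold phiOMinus
  rw [List.dropLast_concat, lastPart_concat, map_add_map_sub, Nat.add_sub_cancel]
  exact sortDesc_eq (List.Perm.refl _) h

theorem psiMinus_eq_phiOMinus {p : List ℕ} {a b : ℕ} (ha : 1 ≤ a) (hb : a + 2 ≤ b) :
    psiMinus (p ++ [b, a]) = phiOMinus (p ++ [b, a]) := by
  unfold psiMinus
  rw [lastPart_append_pair, penultimatePart_append_pair, if_neg (by omega), if_neg (by omega)]

theorem psiMinus_join {p : List ℕ} {k : ℕ} :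
    psiMinus (p ++ [k + 1, k]) = phiMinus (phiCMinus (p ++ [k + 1, k])) := by
  unfold psiMinus
  rw [lastPart_append_pair, penultimatePart_append_pair, if_neg (by omega), if_pos rfl]

theorem psiMinus_zero {p : List ℕ} {b : ℕ} (hb : 2 ≤ b) :
    psiMinus (p ++ [b, 0]) = p ++ [b - 1] := by
  unfold psiMinus
  rw [lastPart_append_pair, penultimatePart_append_pair, if_pos ⟨rfl, hb⟩, dropLast_append_pair,
    phiMinus_concat]

theorem psiPlusOne_of_even {q : List ℕ} {a : ℕ} (h1 : q.Pairwise (· ≥ ·)) (h2 : ∀ x ∈ q, a < x)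
    (ha : Odd a) (hq : ∀ x ∈ q, Even x) : psiPlusOne (q ++ [a]) = q ++ [a + 1, 0] := by
  unfold psiPlusOne
  rw [lastPart_concat, List.dropLast_concat, if_pos ⟨ha, hq⟩, phiPlus_concat h1 h2]
  simp

/-- The first branch requires precisely that the list become entirely even once its last part is
increased. -/
theorem psiPlusOne_of_exists {q : List ℕ} {a : ℕ} (h1 : q.Pairwise (· ≥ ·)) (h2 : ∀ x ∈ q, a < x)
    (h : ∃ x ∈ q ++ [a + 1], Odd x) : psiPlusOne (q ++ [a]) = phiCPlus (q ++ [a + 1]) := by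
  unfold psiPlusOne
  rw [lastPart_concat, List.dropLast_concat, phiPlus_concat h1 h2, if_neg]
  rintro ⟨ha, hq⟩
  obtain ⟨x, hx, hx'⟩ := h
  rcases List.mem_append.1 hx with h | h
  · exact Nat.not_even_iff_odd.2 hx' (hq x h)
  · rw [List.mem_singleton.1 h] at hx'
    exact Nat.not_even_iff_odd.2 hx' ha.add_one

/-- Let a < b be the two smallest parts. If a = 0 and b ≥ 2, all parts are even and b - 1 becomes
the only odd one. If b = a + 1, the sum 2a + 1 dominates all odd parts, so splitting a largest odd
part recovers a and b. Otherwise parities above the last part are kept and a column is removed. -/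
theorem pomega_destruct {l : List ℕ} (hl : l ∈ POmega) (h2 : 2 ≤ l.length) :
    (psiMinus l ∈ POmega ∧ psiPlusOne (psiMinus l) = l ∧ l.length = (psiMinus l).length + 1 ∧
      l.sum = (psiMinus l).sum + 1) ∨
    (psiMinus l ∈ POmega ∧ psiPlusTwo (psiMinus l) = l ∧ l.length = (psiMinus l).length ∧
      l.sum = (psiMinus l).sum + (2 * (psiMinus l).length - 1)) := by
  obtain ⟨p, b, a, rfl⟩ := exists_eq_append_pair h2
  have hl' := hl
  rw [show p ++ [b, a] = p ++ [b] ++ [a] by simp, concat_mem_POmega, pairwise_concat] at hl'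
  obtain ⟨⟨hp, hpb⟩, hlt, hodd⟩ := hl'
  have hab : a < b := hlt b (by simp)
  rcases Nat.lt_or_ge (a + 1) b with hb | hb
  · rcases Nat.eq_zero_or_pos a with rfl | ha
    · left
      rw [psiMinus_zero hb]
      have hev : ∀ x ∈ p ++ [b], Even x := by
        intro x hx
        by_contra hx'
        have h3 := hodd x hx (Nat.not_even_iff_odd.1 hx')
        rcases List.mem_append.1 hx with h | h
        · have := hpb x h
          omega
        · rw [List.mem_singleton.1 h] at h3
          omega
      have hb' : Odd (b - 1) := by
        obtain ⟨k, hk⟩ := hev b (by simp)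
        exact ⟨k - 1, by omega⟩
      have hpb' : ∀ x ∈ p, b - 1 < x := fun x hx => by
        have := hpb x hx
        omega
      have hevp : ∀ x ∈ p, Even x := fun x hx => hev x (List.mem_append_left _ hx)
      refine ⟨concat_mem_POmega.2 ⟨hp, hpb', fun x hx hx' => ?_⟩, ?_, ?_, ?_⟩
      · exact absurd (hevp x hx) (Nat.not_even_iff_odd.2 hx')
      · rw [psiPlusOne_of_even hp hpb' hb' hevp, Nat.sub_add_cancel (by omega)]
      · simp
      · simp only [List.sum_append, List.sum_cons, List.sum_nil]
        omega
    · right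
      rw [psiMinus_eq_phiOMinus ha hb]
      obtain ⟨t, ht⟩ := exists_eq_map_add (l := p ++ [b]) (c := 2) fun x hx => by
        have := hlt x hx
        omega
      obtain ⟨a, rfl⟩ := Nat.exists_eq_add_of_le' ha
      rw [show p ++ [b, a + 1] = p ++ [b] ++ [a + 1] by simp]
      have hpw : (p ++ [b]).Pairwise (· ≥ ·) := pairwise_concat.2 ⟨hp, hpb⟩
      have hb2 : ∀ x ∈ p ++ [b], a + 3 ≤ x := by
        intro x hx
        rcases List.mem_append.1 hx with h | h
        · have := hpb x h
          omega
        · rw [List.mem_singleton.1 h]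
          omega
      rw [ht] at hpw hb2 hodd ⊢
      rw [List.pairwise_map] at hpw
      have hpw' : t.Pairwise (· ≥ ·) := hpw.imp (by intros; omega)
      have hta : ∀ x ∈ t, a < x := fun x hx => by
        have := hb2 (x + 2) (List.mem_map_of_mem hx)
        omega
      rw [phiOMinus_concat (pairwise_concat.2 ⟨hpw', fun x hx => (hta x hx).le⟩)]
      refine ⟨concat_mem_POmega.2 ⟨hpw', hta, fun x hx hx' => ?_⟩, phiOPlus_concat _ _, ?_, ?_⟩
      · have := hodd (x + 2) (List.mem_map_of_mem hx) (by simpa [Nat.odd_add] using hx')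
        omega
      · simp
      · simp only [List.sum_append, List.sum_cons, List.sum_nil, sum_map_add_const,
          List.length_append, List.length_cons, List.length_nil]
        omega
  · left
    obtain rfl : b = a + 1 := by omega
    have hs := sortDesc_perm (p ++ [2 * a + 1])
    have hs' := pairwise_sortDesc (p ++ [2 * a + 1])
    generalize sortDesc (p ++ [2 * a + 1]) = s at hs hs'
    rw [psiMinus_join, phiCMinus_eq hs hs']
    obtain ⟨t, m, rfl⟩ := exists_eq_concat (l := s) (by
      rintro rfl
      simpa using hs.length_eq)
    have hge : ∀ x ∈ t ++ [m], a + 1 ≤ x ∧ (Odd x → x ≤ 2 * a + 1) := by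
      intro x hx
      rcases List.mem_append.1 (hs.mem_iff.1 hx) with h | h
      · exact ⟨hpb x h, hodd x (List.mem_append_left _ h)⟩
      · rw [List.mem_singleton.1 h]
        exact ⟨by omega, fun _ => le_rfl⟩
    -- From m ≥ a + 1 it follows that 2a + 1 ≤ 2(m - 1) + 1, which is the parity bound after the
    -- last part m is lowered.
    have hm := (hge m (by simp)).1
    have hst := pairwise_concat.1 hs'
    have htm : ∀ x ∈ t, m - 1 < x := fun x hx => by
      have := hst.2 x hx
      omega
    rw [phiMinus_concat]
    refine ⟨concat_mem_POmega.2 ⟨hst.1, htm, fun x hx hx' => ?_⟩, ?_, ?_, ?_⟩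
    · have := (hge x (List.mem_append_left _ hx)).2 hx'
      omega
    · have hm1 : m - 1 + 1 = m := by omega
      rw [psiPlusOne_of_exists hst.1 htm (by
        rw [hm1]
        exact ⟨2 * a + 1, hs.mem_iff.2 (by simp), odd_two_mul_add_one a⟩), hm1]
      refine phiCPlus_eq hs (fun x hx => hodd x (List.mem_append_left _ hx)) ?_
      rw [show p ++ [a + 1, a] = p ++ [a + 1] ++ [a] by simp]
      exact pairwise_concat.2 ⟨pairwise_concat.2 ⟨hp, hpb⟩, fun x hx => (hlt x hx).le⟩
    · have := hs.length_eq
      simp only [List.length_append, List.length_cons, List.length_nil] at this ⊢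
      omega
    · have := hs.sum_eq
      simp only [List.sum_append, List.sum_cons, List.sum_nil] at this ⊢
      omega

theorem pomega_row {l : List ℕ} (hl : l ∈ POmega) :
    psiPlusOne l ∈ POmega ∧ psiMinus (psiPlusOne l) = l ∧
      (psiPlusOne l).length = l.length + 1 ∧ (psiPlusOne l).sum = l.sum + 1 := by
  obtain ⟨q, a, rfl⟩ := exists_eq_concat hl.1
  obtain ⟨hq, hlt, hodd⟩ := concat_mem_POmega.1 hl
  have hs : (q ++ [a + 1]).Pairwise (· ≥ ·) := pairwise_concat.2 ⟨hq, hlt⟩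
  by_cases h : ∃ x ∈ q ++ [a + 1], Odd x
  · obtain ⟨p, k, hperm, hsub, hmax⟩ := exists_erase_largestOdd h
    have hge : ∀ x ∈ q ++ [a + 1], a + 1 ≤ x ∧ (Odd x → x ≤ 2 * a + 1) := by
      intro x hx
      rcases List.mem_append.1 hx with h | h
      · exact ⟨hlt x h, hodd x h⟩
      · rw [List.mem_singleton.1 h]
        exact ⟨le_rfl, fun _ => by omega⟩
    -- This means k ≤ a, so the halves k + 1 and k fit at the end of the list, and k becomes the
    -- unique smallest part.
    have hk := (hge (2 * k + 1) (hperm.mem_iff.2 (by simp))).2 (odd_two_mul_add_one k)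
    have hpk : ∀ x ∈ p, k + 1 ≤ x := fun x hx => by
      have := (hge x (hsub.subset hx)).1
      omega
    have hpw : (p ++ [k + 1]).Pairwise (· ≥ ·) := pairwise_concat.2 ⟨hs.sublist hsub, hpk⟩
    have hpk' : ∀ x ∈ p ++ [k + 1], k < x := by
      intro x hx
      rcases List.mem_append.1 hx with h | h
      · exact hpk x h
      · rw [List.mem_singleton.1 h]
        omega
    have heq : p ++ [k + 1, k] = p ++ [k + 1] ++ [k] := by simp
    rw [psiPlusOne_of_exists hq hlt h, phiCPlus_eq hperm
      (fun x hx => hmax x (hsub.subset hx))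
      (heq ▸ pairwise_concat.2 ⟨hpw, fun x hx => (hpk' x hx).le⟩)]
    refine ⟨?_, ?_, ?_, ?_⟩
    · rw [heq]
      refine concat_mem_POmega.2 ⟨hpw, hpk', fun x hx hx' => ?_⟩
      rcases List.mem_append.1 hx with h | h
      · exact hmax x (hsub.subset h) hx'
      · rw [List.mem_singleton.1 h]
        omega
    · rw [psiMinus_join, phiCMinus_eq hperm hs, phiMinus_concat, Nat.add_sub_cancel]
    · have := hperm.length_eq
      simp only [List.length_append, List.length_cons, List.length_nil] at this ⊢
      omega
    · have := hperm.sum_eq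
      simp only [List.sum_append, List.sum_cons, List.sum_nil] at this ⊢
      omega
  · push Not at h
    have hev : ∀ x ∈ q, Even x := fun x hx =>
      Nat.not_odd_iff_even.1 (h x (List.mem_append_left _ hx))
    have ha : Odd a := by
      have := h (a + 1) (by simp)
      rwa [Nat.odd_add_one, not_not] at this
    rw [psiPlusOne_of_even hq hlt ha hev]
    have heq : q ++ [a + 1, 0] = q ++ [a + 1] ++ [0] := by simp
    refine ⟨?_, ?_, by simp, ?_⟩
    · rw [heq]
      refine concat_mem_POmega.2 ⟨hs, fun x hx => ?_, fun x hx hx' => absurd hx' (h x hx)⟩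
      rcases List.mem_append.1 hx with h | h
      · exact (Nat.zero_le a).trans_lt (hlt x h)
      · rw [List.mem_singleton.1 h]
        omega
    · rw [psiMinus_zero (by have := ha.pos; omega), Nat.add_sub_cancel]
    · simp only [List.sum_append, List.sum_cons, List.sum_nil]
      omega

/-- After the step the last part is positive and the gap above it at least 2, so the destructive
operator takes its third branch. -/
theorem pomega_col {l : List ℕ} (hl : l ∈ POmega) (h2 : 2 ≤ l.length) :
    psiPlusTwo l ∈ POmega ∧ psiMinus (psiPlusTwo l) = l ∧
      (psiPlusTwo l).length = l.length ∧ (psiPlusTwo l).sum = l.sum + (2 * l.length - 1) := by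
  obtain ⟨p, b, a, rfl⟩ := exists_eq_append_pair h2
  rw [show p ++ [b, a] = p ++ [b] ++ [a] by simp] at hl ⊢
  obtain ⟨hq, hlt, hodd⟩ := concat_mem_POmega.1 hl
  unfold psiPlusTwo
  rw [phiOPlus_concat]
  refine ⟨concat_mem_POmega.2 ⟨?_, ?_, ?_⟩, ?_, by simp, ?_⟩
  · rw [List.pairwise_map]
    exact hq.imp (by intros; omega)
  · intro x hx
    obtain ⟨y, hy, rfl⟩ := List.mem_map.1 hx
    have := hlt y hy
    omega
  · intro x hx hx'
    obtain ⟨y, hy, rfl⟩ := List.mem_map.1 hx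
    have := hodd y hy (by simpa [Nat.odd_add] using hx')
    omega
  · rw [show (p ++ [b]).map (· + 2) ++ [a + 1] = p.map (· + 2) ++ [b + 2, a + 1] by simp,
      psiMinus_eq_phiOMinus (by omega) (by have := hlt b (by simp); omega),
      show p.map (· + 2) ++ [b + 2, a + 1] = (p ++ [b]).map (· + 2) ++ [a + 1] by simp]
    exact phiOMinus_concat (pairwise_concat.2 ⟨hq, fun x hx => (hlt x hx).le⟩)
  · simp only [List.sum_append, List.sum_cons, List.sum_nil, sum_map_add_const,
      List.length_append, List.length_cons, List.length_nil]
    omega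

/-- Column steps occur only for ℓ ≥ 2 and add 2ℓ - 1 ≥ 3, so the test for the difference 1
identifies the row steps. -/
theorem stepSystem_POmega :
    StepSystem (fun _ => 1) POmega psiMinus List.sum buildOmega (fun n => [n]) where
  ne_nil l hl := hl.1
  start_mem n := (concat_mem_POmega (q := [])).2 (by simp)
  length_start _ := rfl
  size_start n := by simp
  eq_start l _ h := by
    obtain ⟨a, rfl⟩ := List.length_eq_one_iff.1 h
    simp
  destruct l hl h := by
    rcases pomega_destruct hl h with ⟨h1, h2, h3, h4⟩ | ⟨h1, h2, h3, h4⟩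
    · refine ⟨h1, ?_, Or.inl ⟨h3, h4⟩⟩
      rw [h4, Nat.add_sub_cancel_left]
      exact h2
    · refine ⟨h1, ?_, Or.inr ⟨h3, h4⟩⟩
      rw [h4, Nat.add_sub_cancel_left, buildOmega, if_neg (by omega)]
      exact h2
  row l hl := pomega_row hl
  col l hl h := by
    rw [buildOmega, if_neg (by omega)]
    exact pomega_col hl h

/-! ### Partitions into distinct parts -/

theorem concat_mem_PNu {q : List ℕ} {a : ℕ} : q ++ [a] ∈ PNu ↔
    q.Pairwise (· > ·) ∧ (∀ x ∈ q, a < x) ∧ ∀ x ∈ q, Odd x → x < 2 * a := by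
  change (_ ∧ _ ∧ _) ↔ _
  rw [pairwise_concat, lastPart_concat]
  constructor
  · rintro ⟨-, ⟨h1, h2⟩, h3⟩
    exact ⟨h1, h2, fun x hx => h3 x (List.mem_append_left _ hx)⟩
  · rintro ⟨h1, h2, h3⟩
    refine ⟨by simp, ⟨h1, h2⟩, fun x hx hx' => ?_⟩
    rcases List.mem_append.1 hx with h | h
    · exact h3 x h hx'
    · rw [List.mem_singleton.1 h] at hx' ⊢
      have := hx'.pos
      omega

theorem rhoMinus_eq_phiOMinus {p : List ℕ} {a b : ℕ} (ha : 1 ≤ a) (hb : a + 2 ≤ b) :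
    rhoMinus (p ++ [b, a]) = phiOMinus (p ++ [b, a]) := by
  unfold rhoMinus
  rw [lastPart_append_pair, penultimatePart_append_pair, if_neg (by omega), if_neg (by omega)]

theorem rhoMinus_join {p : List ℕ} {k : ℕ} (hk : 1 ≤ k) :
    rhoMinus (p ++ [k + 1, k]) = phiEMinus (phiCMinus (p ++ [k + 1, k])) := by
  unfold rhoMinus
  rw [lastPart_append_pair, penultimatePart_append_pair, if_neg (by omega), if_pos rfl]

theorem rhoMinus_zero (q : List ℕ) : rhoMinus (q ++ [0]) = phiEMinus q := by
  unfold rhoMinus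
  rw [lastPart_concat, if_pos rfl, List.dropLast_concat]

theorem rhoPlusOne_of_even {l : List ℕ} (h : ∀ x ∈ l, Even x) :
    rhoPlusOne l = l.map (· + 2) ++ [0] := if_pos h

theorem rhoPlusOne_of_exists {l : List ℕ} (h : ∃ x ∈ l, Odd x) :
    rhoPlusOne l = phiCPlus (l.map (· + 2)) := by
  refine if_neg fun h' => ?_
  obtain ⟨x, hx, hx'⟩ := h
  exact Nat.not_even_iff_odd.2 hx' (h' x hx)

theorem pairwise_map_add {l : List ℕ} {c : ℕ} :
    (l.map (· + c)).Pairwise (· > ·) ↔ l.Pairwise (· > ·) := by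
  rw [List.pairwise_map]
  simp

theorem pairwise_ge {l : List ℕ} (h : l.Pairwise (· > ·)) : l.Pairwise (· ≥ ·) :=
  h.imp fun h => le_of_lt h

theorem mem_PNu_of_even {l : List ℕ} (h0 : l ≠ []) (hl : l.Pairwise (· > ·))
    (h : ∀ x ∈ l, Even x) : l ∈ PNu :=
  ⟨h0, hl, fun x hx hx' => absurd (h x hx) (Nat.not_even_iff_odd.2 hx')⟩

/-- The cases are those for `POmega`, with a row worth 2ℓ. A zero last part forces all parts to be
even, since odd parts would be negative. -/
theorem pnu_destruct {l : List ℕ} (hl : l ∈ PNu) (h2 : 2 ≤ l.length) :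
    (rhoMinus l ∈ PNu ∧ rhoPlusOne (rhoMinus l) = l ∧ l.length = (rhoMinus l).length + 1 ∧
      l.sum = (rhoMinus l).sum + 2 * (rhoMinus l).length) ∨
    (rhoMinus l ∈ PNu ∧ rhoPlusTwo (rhoMinus l) = l ∧ l.length = (rhoMinus l).length ∧
      l.sum = (rhoMinus l).sum + (2 * (rhoMinus l).length - 1)) := by
  obtain ⟨p, b, a, rfl⟩ := exists_eq_append_pair h2
  have heq : p ++ [b, a] = p ++ [b] ++ [a] := by simp
  have hl' := hl
  rw [heq, concat_mem_PNu] at hl'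
  obtain ⟨hpw, hlt, hodd⟩ := hl'
  obtain ⟨hp, hpb⟩ := pairwise_concat.1 hpw
  have hab : a < b := hlt b (by simp)
  rcases Nat.eq_zero_or_pos a with rfl | ha
  · left
    have hev : ∀ x ∈ p ++ [b], Even x := by
      intro x hx
      by_contra hx'
      have := hodd x hx (Nat.not_even_iff_odd.1 hx')
      omega
    obtain ⟨t, ht⟩ := exists_eq_map_add (l := p ++ [b]) (c := 2) fun x hx => by
      have h3 := hlt x hx
      obtain ⟨k, hk⟩ := hev x hx
      omega
    rw [heq, rhoMinus_zero, phiEMinus]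
    have hlen : (p ++ [b]).length ≠ 0 := by simp
    rw [ht] at hpw hev hlen ⊢
    rw [map_add_map_sub]
    have hev' : ∀ x ∈ t, Even x := fun x hx => by
      simpa [Nat.even_add] using hev (x + 2) (List.mem_map_of_mem hx)
    refine ⟨mem_PNu_of_even ?_ (pairwise_map_add.1 hpw) hev', rhoPlusOne_of_even hev',
      by simp, by simp [mul_comm]⟩
    rintro rfl
    simp at hlen
  · rcases Nat.lt_or_ge (a + 1) b with hb | hb
    · right
      rw [rhoMinus_eq_phiOMinus ha hb]
      obtain ⟨t, ht⟩ := exists_eq_map_add (l := p ++ [b]) (c := 2) fun x hx => by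
        have := hlt x hx
        omega
      obtain ⟨a, rfl⟩ := Nat.exists_eq_add_of_le' ha
      rw [heq]
      have hb2 : ∀ x ∈ p ++ [b], a + 3 ≤ x := by
        intro x hx
        rcases List.mem_append.1 hx with h | h
        · have := hpb x h
          omega
        · rw [List.mem_singleton.1 h]
          omega
      rw [ht] at hpw hb2 hodd ⊢
      rw [pairwise_map_add] at hpw
      have hta : ∀ x ∈ t, a < x := fun x hx => by
        have := hb2 (x + 2) (List.mem_map_of_mem hx)
        omega
      rw [phiOMinus_concat (pairwise_ge (pairwise_concat.2 ⟨hpw, hta⟩))]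
      refine ⟨concat_mem_PNu.2 ⟨hpw, hta, fun x hx hx' => ?_⟩, phiOPlus_concat _ _, ?_, ?_⟩
      · have := hodd (x + 2) (List.mem_map_of_mem hx) (by simpa [Nat.odd_add] using hx')
        omega
      · simp
      · simp only [List.sum_append, List.sum_cons, List.sum_nil, sum_map_add_const,
          List.length_append, List.length_cons, List.length_nil]
        omega
    · left
      obtain rfl : b = a + 1 := by omega
      have hs := sortDesc_perm (p ++ [2 * a + 1])
      have hs' := pairwise_sortDesc (p ++ [2 * a + 1])
      generalize sortDesc (p ++ [2 * a + 1]) = s at hs hs'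
      -- The odd parts of `p` are strictly below 2a, so the joined part 2a + 1 is new.
      have hnd : s.Nodup := by
        refine hs.nodup_iff.2 (List.nodup_append.2 ⟨hp.imp (fun h => ne_of_gt h),
          List.nodup_singleton _, fun x hx y hy => ?_⟩)
        rw [List.mem_singleton.1 hy]
        rintro rfl
        have := hodd _ (List.mem_append_left _ hx) (odd_two_mul_add_one a)
        omega
      have hgt : s.Pairwise (· > ·) := (hs'.and hnd).imp fun h => lt_of_le_of_ne h.1 h.2.symm
      have hge : ∀ x ∈ s, a + 2 ≤ x ∧ (Odd x → x ≤ 2 * a + 1) := by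
        intro x hx
        rcases List.mem_append.1 (hs.mem_iff.1 hx) with h | h
        · refine ⟨hpb x h, fun hx' => ?_⟩
          have := hodd x (List.mem_append_left _ h) hx'
          omega
        · rw [List.mem_singleton.1 h]
          exact ⟨by omega, fun _ => le_rfl⟩
      rw [rhoMinus_join ha, phiCMinus_eq hs hs', phiEMinus]
      obtain ⟨t, rfl⟩ := exists_eq_map_add (l := s) (c := 2) fun x hx => by
        have := (hge x hx).1
        omega
      rw [map_add_map_sub]
      have hmem : 2 * a + 1 ∈ t.map (· + 2) := hs.mem_iff.2 (by simp)
      have hlen := hs.length_eq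
      have hsum := hs.sum_eq
      simp only [List.length_append, List.length_cons, List.length_nil, List.length_map] at hlen
      simp only [List.sum_append, List.sum_cons, List.sum_nil, sum_map_add_const] at hsum
      refine ⟨?_, ?_, ?_, ?_⟩
      · obtain ⟨u, m, rfl⟩ := exists_eq_concat (l := t) (by rintro rfl; simp at hlen)
        obtain ⟨hu, hum⟩ := pairwise_concat.1 (pairwise_map_add.1 hgt)
        refine concat_mem_PNu.2 ⟨hu, hum, fun x hx hx' => ?_⟩
        have h3 := (hge (x + 2) (List.mem_map_of_mem (List.mem_append_left _ hx))).2
          (by simpa [Nat.odd_add] using hx')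
        have h4 := (hge (m + 2) (List.mem_map_of_mem (by simp))).1
        omega
      · obtain ⟨x, hx, hx'⟩ := List.mem_map.1 hmem
        rw [rhoPlusOne_of_exists ⟨x, hx, ⟨a - 1, by omega⟩⟩]
        refine phiCPlus_eq hs (fun x hx hx' => ?_) (pairwise_ge ?_)
        · exact (hge x (hs.mem_iff.2 (List.mem_append_left _ hx))).2 hx'
        · rw [heq]
          exact pairwise_concat.2 ⟨hpw, hlt⟩
      · simp only [List.length_append, List.length_cons, List.length_nil]
        omega
      · simp only [List.sum_append, List.sum_cons, List.sum_nil]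
        omega

theorem pnu_row {l : List ℕ} (hl : l ∈ PNu) :
    rhoPlusOne l ∈ PNu ∧ rhoMinus (rhoPlusOne l) = l ∧
      (rhoPlusOne l).length = l.length + 1 ∧ (rhoPlusOne l).sum = l.sum + 2 * l.length := by
  by_cases h : ∃ x ∈ l, Odd x
  · have hs : (l.map (· + 2)).Pairwise (· > ·) := pairwise_map_add.2 hl.2.1
    obtain ⟨p, k, hperm, hsub, hmax⟩ := exists_erase_largestOdd (s := l.map (· + 2)) (by
      obtain ⟨x, hx, hx'⟩ := h
      exact ⟨x + 2, List.mem_map_of_mem hx, by simpa [Nat.odd_add] using hx'⟩)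
    -- The largest odd part before the shift is 2k - 1 < 2a, with a the last part. Thus k ≤ a, while
    -- all shifted parts are at least a + 2.
    have hge : ∀ x ∈ l.map (· + 2), k + 2 ≤ x := by
      have hmem : 2 * k + 1 ∈ l.map (· + 2) := hperm.mem_iff.2 (by simp)
      obtain ⟨y, hy, hy'⟩ := List.mem_map.1 hmem
      obtain ⟨q, a, rfl⟩ := exists_eq_concat hl.1
      have hy2 := hl.2.2 y hy ⟨k - 1, by omega⟩
      rw [lastPart_concat] at hy2
      intro x hx
      obtain ⟨w, hw, rfl⟩ := List.mem_map.1 hx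
      rcases List.mem_append.1 hw with h | h
      · have := (concat_mem_PNu.1 hl).2.1 w h
        omega
      · rw [List.mem_singleton.1 h]
        omega
    have hk : 1 ≤ k := by
      have := hge (2 * k + 1) (hperm.mem_iff.2 (by simp))
      omega
    have hpk : ∀ x ∈ p, k + 1 < x := fun x hx => hge x (hsub.subset hx)
    have hpw : (p ++ [k + 1]).Pairwise (· > ·) := pairwise_concat.2 ⟨hs.sublist hsub, hpk⟩
    have hpk' : ∀ x ∈ p ++ [k + 1], k < x := by
      intro x hx
      rcases List.mem_append.1 hx with h | h
      · have := hpk x h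
        omega
      · rw [List.mem_singleton.1 h]
        omega
    have heq : p ++ [k + 1, k] = p ++ [k + 1] ++ [k] := by simp
    have hlen := hperm.length_eq
    have hsum := hperm.sum_eq
    simp only [List.length_append, List.length_cons, List.length_nil, List.length_map] at hlen
    simp only [List.sum_append, List.sum_cons, List.sum_nil, sum_map_add_const] at hsum
    -- Distinctness sharpens the bound 2k + 1 on the remaining odd parts to the strict bound 2k
    -- required with the new last part k.
    have hnd : (p ++ [2 * k + 1]).Nodup := hperm.nodup_iff.1 (hs.imp fun h => ne_of_gt h)
    rw [rhoPlusOne_of_exists h, phiCPlus_eq hperm (fun x hx => hmax x (hsub.subset hx))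
      (heq ▸ pairwise_ge (pairwise_concat.2 ⟨hpw, hpk'⟩))]
    refine ⟨?_, ?_, ?_, ?_⟩
    · rw [heq]
      refine concat_mem_PNu.2 ⟨hpw, hpk', fun x hx hx' => ?_⟩
      rcases List.mem_append.1 hx with h | h
      · have h3 := hmax x (hsub.subset h) hx'
        have h4 : x ≠ 2 * k + 1 := (List.nodup_append.1 hnd).2.2 x h _ (by simp)
        obtain ⟨j, rfl⟩ := hx'
        omega
      · rw [List.mem_singleton.1 h] at hx' ⊢
        obtain ⟨j, hj⟩ := hx'
        omega
    · rw [rhoMinus_join hk, phiCMinus_eq hperm (pairwise_ge hs), phiEMinus, map_add_map_sub]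
    · simp only [List.length_append, List.length_cons, List.length_nil]
      omega
    · simp only [List.sum_append, List.sum_cons, List.sum_nil]
      omega
  · push Not at h
    have hev : ∀ x ∈ l, Even x := fun x hx => Nat.not_odd_iff_even.1 (h x hx)
    rw [rhoPlusOne_of_even hev]
    refine ⟨mem_PNu_of_even (by simp) (pairwise_concat.2 ⟨pairwise_map_add.2 hl.2.1, ?_⟩) ?_,
      ?_, by simp, ?_⟩
    · intro x hx
      obtain ⟨y, -, rfl⟩ := List.mem_map.1 hx
      omega
    · intro x hx
      rcases List.mem_append.1 hx with h | h
      · obtain ⟨y, hy, rfl⟩ := List.mem_map.1 h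
        simpa [Nat.even_add] using hev y hy
      · rw [List.mem_singleton.1 h]
        exact Even.zero
    · rw [rhoMinus_zero, phiEMinus, map_add_map_sub]
    · simp [mul_comm]

theorem pnu_col {l : List ℕ} (hl : l ∈ PNu) (h2 : 2 ≤ l.length) :
    rhoPlusTwo l ∈ PNu ∧ rhoMinus (rhoPlusTwo l) = l ∧
      (rhoPlusTwo l).length = l.length ∧ (rhoPlusTwo l).sum = l.sum + (2 * l.length - 1) := by
  obtain ⟨p, b, a, rfl⟩ := exists_eq_append_pair h2
  rw [show p ++ [b, a] = p ++ [b] ++ [a] by simp] at hl ⊢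
  obtain ⟨hq, hlt, hodd⟩ := concat_mem_PNu.1 hl
  unfold rhoPlusTwo
  rw [phiOPlus_concat]
  refine ⟨concat_mem_PNu.2 ⟨pairwise_map_add.2 hq, ?_, ?_⟩, ?_, by simp, ?_⟩
  · intro x hx
    obtain ⟨y, hy, rfl⟩ := List.mem_map.1 hx
    have := hlt y hy
    omega
  · intro x hx hx'
    obtain ⟨y, hy, rfl⟩ := List.mem_map.1 hx
    have := hodd y hy (by simpa [Nat.odd_add] using hx')
    omega
  · rw [show (p ++ [b]).map (· + 2) ++ [a + 1] = p.map (· + 2) ++ [b + 2, a + 1] by simp,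
      rhoMinus_eq_phiOMinus (by omega) (by have := hlt b (by simp); omega),
      show p.map (· + 2) ++ [b + 2, a + 1] = (p ++ [b]).map (· + 2) ++ [a + 1] by simp]
    exact phiOMinus_concat (pairwise_ge (pairwise_concat.2 ⟨hq, hlt⟩))
  · simp only [List.sum_append, List.sum_cons, List.sum_nil, sum_map_add_const,
      List.length_append, List.length_cons, List.length_nil]
    omega

theorem not_even_col {k : ℕ} (hk : 1 ≤ k) : ¬ Even (2 * k - 1) := by
  rw [Nat.not_even_iff_odd]
  exact ⟨k - 1, by omega⟩

/-- Rows add the even number 2ℓ and columns the odd number 2ℓ - 1, so parity identifies the kind of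
step. -/
theorem stepSystem_PNu :
    StepSystem (fun k => 2 * k) PNu rhoMinus List.sum buildNu (fun n => [n]) where
  ne_nil l hl := hl.1
  start_mem n := (concat_mem_PNu (q := [])).2 (by simp)
  length_start _ := rfl
  size_start n := by simp
  eq_start l _ h := by
    obtain ⟨a, rfl⟩ := List.length_eq_one_iff.1 h
    simp
  destruct l hl h := by
    rcases pnu_destruct hl h with ⟨h1, h2, h3, h4⟩ | ⟨h1, h2, h3, h4⟩
    · refine ⟨h1, ?_, Or.inl ⟨h3, h4⟩⟩
      rw [h4, Nat.add_sub_cancel_left, buildNu, if_pos (even_two_mul _)]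
      exact h2
    · refine ⟨h1, ?_, Or.inr ⟨h3, h4⟩⟩
      rw [h4, Nat.add_sub_cancel_left, buildNu, if_neg (not_even_col (by omega))]
      exact h2
  row l hl := by
    rw [buildNu, if_pos (even_two_mul _)]
    exact pnu_row hl
  col l hl h := by
    rw [buildNu, if_neg (not_even_col (by omega))]
    exact pnu_col hl h

/-! ### Odd Ferrers graphs -/

theorem sum_boxEntry_zero (a : ℕ) : ∑ j ∈ Finset.range a, boxEntry 0 j = a - 1 := by
  rcases a with _ | a
  · rfl
  · rw [Finset.sum_range_succ']
    simp [boxEntry]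

theorem sum_boxEntry_succ (i a : ℕ) :
    ∑ j ∈ Finset.range a, boxEntry (i + 1) j = 2 * a - 1 := by
  rcases a with _ | a
  · rfl
  · rw [Finset.sum_range_succ']
    simp [boxEntry]
    omega

theorem sum_range_getD (g : ℕ → ℕ) (l : List ℕ) :
    ∑ i ∈ Finset.range l.length, g (l.getD i 0) = (l.map g).sum := by
  induction l with
  | nil => simp
  | cons x t ih =>
    rw [List.length_cons, Finset.sum_range_succ']
    simp only [List.getD_cons_succ, List.getD_cons_zero, ih, List.map_cons, List.sum_cons]
    ring

theorem sum_map_two_mul_sub_one {l : List ℕ} (h : ∀ a ∈ l, 0 < a) :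
    (l.map fun a => 2 * a - 1).sum + l.length = 2 * l.sum := by
  induction l with
  | nil => simp
  | cons x t ih =>
    have h1 := ih fun a ha => h a (List.mem_cons_of_mem _ ha)
    have h2 := h x List.mem_cons_self
    simp only [List.map_cons, List.sum_cons, List.length_cons]
    omega

/-- A row of a boxes contributes 2a - 1, except that the first contributes a - 1. The additive form
avoids truncated subtraction. -/
theorem graphSize_eq {l : List ℕ} (h0 : l ≠ []) (h : ∀ a ∈ l, 0 < a) :
    graphSize l + l.length + l.headD 0 = 2 * l.sum := by
  obtain ⟨x, t, rfl⟩ := List.exists_cons_of_ne_nil h0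
  unfold graphSize
  rw [List.length_cons, Finset.sum_range_succ']
  simp only [List.getD_cons_succ, List.getD_cons_zero, sum_boxEntry_zero, sum_boxEntry_succ]
  rw [sum_range_getD fun a => 2 * a - 1]
  have h1 := sum_map_two_mul_sub_one fun a ha => h a (List.mem_cons_of_mem _ ha)
  have h2 := h x List.mem_cons_self
  simp only [List.headD_cons, List.sum_cons]
  omega

theorem graphSize_concat_one {l : List ℕ} (h0 : l ≠ []) (h : ∀ a ∈ l, 0 < a) :
    graphSize (l ++ [1]) = graphSize l + 1 := by
  have h1 := graphSize_eq h0 h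
  have h2 := graphSize_eq (l := l ++ [1]) (by simp) fun a ha => by
    rcases List.mem_append.1 ha with h' | h'
    · exact h a h'
    · rw [List.mem_singleton.1 h']
      omega
  have h3 : (l ++ [1]).headD 0 = l.headD 0 := by
    obtain ⟨x, t, rfl⟩ := List.exists_cons_of_ne_nil h0
    rfl
  simp only [List.length_append, List.sum_append, List.sum_cons, List.sum_nil, List.length_cons,
    List.length_nil] at h2
  omega

theorem graphSize_map_succ {l : List ℕ} (h0 : l ≠ []) (h : ∀ a ∈ l, 0 < a) :
    graphSize (l.map (· + 1)) = graphSize l + (2 * l.length - 1) := by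
  have h1 := graphSize_eq h0 h
  have h2 := graphSize_eq (l := l.map (· + 1)) (by simpa using h0) fun a ha => by
    obtain ⟨y, -, rfl⟩ := List.mem_map.1 ha
    omega
  have h3 : (l.map (· + 1)).headD 0 = l.headD 0 + 1 := by
    obtain ⟨x, t, rfl⟩ := List.exists_cons_of_ne_nil h0
    rfl
  have h4 := List.length_pos_iff.2 h0
  simp only [sum_map_add_const, List.length_map] at h2
  omega

theorem graphSize_singleton (n : ℕ) : graphSize [n + 1] = n := by
  simp [graphSize, sum_boxEntry_zero]

theorem dropZeros_of_pos {l : List ℕ} (h : ∀ a ∈ l, 0 < a) : dropZeros l = l :=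
  List.filter_eq_self.2 fun a ha => by simpa using h a ha

theorem dropZeros_concat_zero {l : List ℕ} (h : ∀ a ∈ l, 0 < a) : dropZeros (l ++ [0]) = l := by
  have := dropZeros_of_pos h
  unfold dropZeros at this ⊢
  rw [List.filter_append, this]
  simp

theorem pos_of_mem_map_succ {l : List ℕ} : ∀ a ∈ l.map (· + 1), 0 < a := by
  intro a ha
  obtain ⟨y, -, rfl⟩ := List.mem_map.1 ha
  omega

theorem pos_of_mem_concat_one {l : List ℕ} (h : ∀ a ∈ l, 0 < a) : ∀ a ∈ l ++ [1], 0 < a := by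
  intro a ha
  rcases List.mem_append.1 ha with h' | h'
  · exact h a h'
  · rw [List.mem_singleton.1 h']
    omega

theorem two_le_lastPart_map_succ {l : List ℕ} (h0 : l ≠ []) (h : ∀ a ∈ l, 0 < a) :
    2 ≤ lastPart (l.map (· + 1)) := by
  obtain ⟨q, a, rfl⟩ := exists_eq_concat h0
  rw [List.map_append, List.map_singleton, lastPart_concat]
  have := h a (by simp)
  omega

theorem shrinkOmega_map_succ {l : List ℕ} (h0 : l ≠ []) (h : ∀ a ∈ l, 0 < a) :
    shrinkOmega (l.map (· + 1)) = l := by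
  rw [shrinkOmega, if_pos (two_le_lastPart_map_succ h0 h), phiStar, map_add_map_sub]

theorem shrinkOmega_concat_one {l : List ℕ} (h : ∀ a ∈ l, 0 < a) :
    shrinkOmega (l ++ [1]) = l := by
  rw [shrinkOmega, lastPart_concat, if_neg (by omega), phiMinus_concat]
  exact dropZeros_concat_zero h

theorem shrinkNu_map_succ {l : List ℕ} (h : ∀ a ∈ l, 0 < a) :
    shrinkNu (l.map (· + 1)) = l := by
  rw [shrinkNu, phiStar, map_add_map_sub, dropZeros_of_pos h]

theorem shrinkNu_concat_one {l : List ℕ} (h : ∀ a ∈ l, 0 < a) :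
    shrinkNu (l.map (· + 1) ++ [1]) = l := by
  rw [shrinkNu, phiStar, List.map_append, map_add_map_sub]
  exact dropZeros_concat_zero h

/-- The rows are nonincreasing, so if the last has two boxes, all survive the loss of a column. The
starting row has n + 1 boxes because the corner counts 0. -/
theorem stepSystem_BOmega :
    StepSystem (fun _ => 1) BOmega shrinkOmega graphSize growOmega (fun n => [n + 1]) where
  ne_nil l hl := hl.1
  start_mem n := ⟨by simp, by simp, by simp⟩
  length_start _ := rfl
  size_start := graphSize_singleton
  eq_start l hl h := by
    obtain ⟨a, rfl⟩ := List.length_eq_one_iff.1 h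
    obtain ⟨n, rfl⟩ := Nat.exists_eq_add_of_le' (hl.2.2 a (by simp))
    rw [graphSize_singleton]
  destruct l hl h := by
    obtain ⟨h0, hpw, hpos⟩ := hl
    by_cases h2 : 2 ≤ lastPart l
    · have hge : ∀ x ∈ l, 2 ≤ x := by
        obtain ⟨q, a, rfl⟩ := exists_eq_concat h0
        rw [lastPart_concat] at h2
        intro x hx
        rcases List.mem_append.1 hx with h' | h'
        · exact h2.trans ((pairwise_concat.1 hpw).2 x h')
        · rwa [List.mem_singleton.1 h']
      obtain ⟨t, rfl⟩ := exists_eq_map_add hpos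
      have ht0 : t ≠ [] := by simpa using h0
      have ht : ∀ a ∈ t, 0 < a := fun a ha => by
        have := hge (a + 1) (List.mem_map_of_mem ha)
        omega
      have h3 := graphSize_map_succ ht0 ht
      rw [List.length_map] at h
      rw [shrinkOmega_map_succ ht0 ht]
      refine ⟨⟨ht0, ?_, ht⟩, ?_, Or.inr ⟨by simp, h3⟩⟩
      · exact (List.pairwise_map.1 hpw).imp (by intros; omega)
      · rw [h3, Nat.add_sub_cancel_left, growOmega, if_neg (by omega)]
    · obtain ⟨q, a, rfl⟩ := exists_eq_concat h0
      rw [lastPart_concat] at h2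
      obtain rfl : a = 1 := by
        have := hpos a (by simp)
        omega
      have hq0 : q ≠ [] := by
        rintro rfl
        simp at h
      have hq : ∀ a ∈ q, 0 < a := fun a ha => hpos a (List.mem_append_left _ ha)
      have h3 := graphSize_concat_one hq0 hq
      rw [shrinkOmega_concat_one hq]
      refine ⟨⟨hq0, (pairwise_concat.1 hpw).1, hq⟩, ?_, Or.inl ⟨by simp, h3⟩⟩
      rw [h3, Nat.add_sub_cancel_left]
      rfl
  row l hl := by
    obtain ⟨h0, hpw, hpos⟩ := hl
    rw [growOmega, if_pos rfl]
    exact ⟨⟨by simp, pairwise_concat.2 ⟨hpw, hpos⟩, pos_of_mem_concat_one hpos⟩,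
      shrinkOmega_concat_one hpos, by simp, graphSize_concat_one h0 hpos⟩
  col l hl h := by
    obtain ⟨h0, hpw, hpos⟩ := hl
    rw [growOmega, if_neg (by omega)]
    exact ⟨⟨by simpa using h0, List.pairwise_map.2 (hpw.imp (by intros; omega)),
      pos_of_mem_map_succ⟩, shrinkOmega_map_succ h0 hpos, by simp, graphSize_map_succ h0 hpos⟩

/-- Among distinct rows only the last can be a single box, so deleting a column loses at most one
row. A row step is a column followed by a one-box row and adds (2ℓ - 1) + 1 = 2ℓ. -/
theorem stepSystem_BNu :
    StepSystem (fun k => 2 * k) BNu shrinkNu graphSize growNu (fun n => [n + 1]) where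
  ne_nil l hl := hl.1
  start_mem n := ⟨by simp, by simp, by simp⟩
  length_start _ := rfl
  size_start := graphSize_singleton
  eq_start l hl h := by
    obtain ⟨a, rfl⟩ := List.length_eq_one_iff.1 h
    obtain ⟨n, rfl⟩ := Nat.exists_eq_add_of_le' (hl.2.2 a (by simp))
    rw [graphSize_singleton]
  destruct l hl h := by
    obtain ⟨h0, hpw, hpos⟩ := hl
    obtain ⟨t, rfl⟩ := exists_eq_map_add hpos
    have ht0 : t ≠ [] := by simpa using h0
    rw [pairwise_map_add] at hpw
    obtain ⟨q, a, rfl⟩ := exists_eq_concat ht0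
    obtain ⟨hq, hqa⟩ := pairwise_concat.1 hpw
    rcases Nat.eq_zero_or_pos a with rfl | ha
    · have hq0 : q ≠ [] := by
        rintro rfl
        simp at h
      have h3 : graphSize (q.map (· + 1) ++ [1]) = graphSize q + 2 * q.length := by
        rw [graphSize_concat_one (by simpa using hq0) pos_of_mem_map_succ,
          graphSize_map_succ hq0 hqa]
        have := List.length_pos_iff.2 hq0
        omega
      rw [List.map_append, List.map_singleton, Nat.zero_add, shrinkNu_concat_one hqa]
      refine ⟨⟨hq0, hq, hqa⟩, ?_, Or.inl ⟨by simp, h3⟩⟩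
      rw [h3, Nat.add_sub_cancel_left, growNu, if_pos (even_two_mul _)]
    · have ht : ∀ x ∈ q ++ [a], 0 < x := by
        intro x hx
        rcases List.mem_append.1 hx with h' | h'
        · exact ha.trans (hqa x h')
        · rwa [List.mem_singleton.1 h']
      have h3 := graphSize_map_succ ht0 ht
      rw [shrinkNu_map_succ ht]
      refine ⟨⟨ht0, hpw, ht⟩, ?_, Or.inr ⟨by simp, h3⟩⟩
      rw [h3, Nat.add_sub_cancel_left, growNu, if_neg (not_even_col (by simp))]
  row l hl := by
    obtain ⟨h0, hpw, hpos⟩ := hl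
    rw [growNu, if_pos (even_two_mul _)]
    refine ⟨⟨by simp, pairwise_concat.2 ⟨pairwise_map_add.2 hpw, fun x hx => ?_⟩,
      pos_of_mem_concat_one pos_of_mem_map_succ⟩, shrinkNu_concat_one hpos, by simp, ?_⟩
    · obtain ⟨y, hy, rfl⟩ := List.mem_map.1 hx
      have := hpos y hy
      omega
    · rw [graphSize_concat_one (by simpa using h0) pos_of_mem_map_succ,
        graphSize_map_succ h0 hpos]
      have := List.length_pos_iff.2 h0
      omega
  col l hl h := by
    obtain ⟨h0, hpw, hpos⟩ := hl
    rw [growNu, if_neg (not_even_col (by omega))]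
    exact ⟨⟨by simpa using h0, pairwise_map_add.2 hpw, pos_of_mem_map_succ⟩,
      shrinkNu_map_succ hpos, by simp, graphSize_map_succ h0 hpos⟩

/-! ### Generating functions -/

/-- Each partial sum satisfies S ≤ G + x^k S with G the sum of g, hence S ≤ G / (1 - x^k). -/
theorem summable_of_shift {b g : ℕ → ℝ} {k : ℕ} {x : ℝ} (hx0 : 0 ≤ x) (hx : x < 1) (hk : k ≠ 0)
    (hb : ∀ n, 0 ≤ b n) (hg0 : ∀ n, 0 ≤ g n) (hg : Summable g)
    (h : ∀ n, b n = g n + if k ≤ n then x ^ k * b (n - k) else 0) : Summable b := by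
  have hxk : x ^ k < 1 := pow_lt_one₀ hx0 hx hk
  refine summable_of_sum_range_le (c := (∑' n, g n) / (1 - x ^ k)) hb fun N => ?_
  rw [le_div_iff₀ (by linarith)]
  have h1 : ∑ n ∈ Finset.range N, (if k ≤ n then x ^ k * b (n - k) else 0) ≤
      x ^ k * ∑ n ∈ Finset.range N, b n := by
    have h4 : ∀ n, 0 ≤ if k ≤ n then x ^ k * b (n - k) else 0 := fun n => by
      split_ifs
      · exact mul_nonneg (pow_nonneg hx0 _) (hb _)
      · exact le_rfl
    refine (Finset.sum_le_sum_of_subset_of_nonneg (Finset.range_subset_range.2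
      (Nat.le_add_left N k)) fun n _ _ => h4 n).trans_eq ?_
    rw [Finset.sum_range_add, Finset.sum_eq_zero fun n hn =>
      if_neg (not_le.2 (Finset.mem_range.1 hn)), zero_add, Finset.mul_sum]
    simp
  have h2 : ∑ n ∈ Finset.range N, b n = ∑ n ∈ Finset.range N, g n +
      ∑ n ∈ Finset.range N, (if k ≤ n then x ^ k * b (n - k) else 0) := by
    rw [← Finset.sum_add_distrib]
    exact Finset.sum_congr rfl fun n _ => h n
  have h3 := hg.sum_le_tsum (Finset.range N) fun n _ => hg0 n
  linarith

theorem hasSum_shift {a : ℕ → ℂ} {q S : ℂ} (k : ℕ) (h : HasSum (fun n => a n * q ^ n) S) :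
    HasSum (fun n => (if k ≤ n then a (n - k) else 0) * q ^ n) (q ^ k * S) := by
  have h1 : HasSum (fun n => (if k ≤ n + k then a (n + k - k) else 0) * q ^ (n + k))
      (q ^ k * S) := by
    refine (h.mul_left (q ^ k)).congr_fun fun n => ?_
    rw [if_pos (by omega), Nat.add_sub_cancel]
    ring
  have h2 := (hasSum_nat_add_iff
    (f := fun n => (if k ≤ n then a (n - k) else 0) * q ^ n) k).1 h1
  rwa [Finset.sum_eq_zero, add_zero] at h2
  intro n hn
  rw [if_neg (by simpa using hn), zero_mul]

namespace StepSystem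

variable {e : ℕ → ℕ} {P : Set (List ℕ)} {f : List ℕ → List ℕ} {size : List ℕ → ℕ}
  {build : ℕ → List ℕ → List ℕ} {start : ℕ → List ℕ}

theorem summable_ncard (S : StepSystem e P f size build start) {x : ℝ} (hx0 : 0 ≤ x) (hx : x < 1)
    (m : ℕ) : Summable fun n => ((sizeClass P size m n).ncard : ℝ) * x ^ n := by
  induction m with
  | zero =>
    simp only [S.ncard_sizeClass_zero, Nat.cast_one, one_mul]
    exact summable_geometric_of_lt_one hx0 hx
  | succ m ih =>
    refine summable_of_shift (k := 2 * m + 3) (g := fun n => if e (m + 1) ≤ n then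
      x ^ e (m + 1) * ((sizeClass P size m (n - e (m + 1))).ncard * x ^ (n - e (m + 1))) else 0)
      hx0 hx (by omega) (fun n => by positivity) (fun n => by positivity) ?_ ?_
    · rw [← summable_nat_add_iff (e (m + 1))]
      simpa using ih.mul_left (x ^ e (m + 1))
    · intro n
      rw [S.ncard_sizeClass_succ]
      push_cast
      rw [add_mul]
      congr 1
      · split_ifs with h
        · rw [mul_left_comm, ← pow_add, Nat.add_sub_cancel' h]
        · simp
      · split_ifs with h
        · rw [mul_left_comm, ← pow_add, Nat.add_sub_cancel' h]
        · simp

/-- The recurrence says A_{m+1} = q^(e(m+1)) A_m + q^(2m+3) A_{m+1}. Solving it is legitimate once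
convergence is known, and adds the factor 1 - q^(2m+3) to the denominator. -/
theorem hasSum_ncard (S : StepSystem e P f size build start) {q : ℂ} (hq : ‖q‖ < 1) (m : ℕ) :
    HasSum (fun n => ((sizeClass P size m n).ncard : ℂ) * q ^ n)
      (q ^ (∑ i ∈ Finset.range m, e (i + 1)) / qPoch q (q ^ 2) (m + 1)) := by
  have hq1 : ∀ k : ℕ, 1 - q ^ (k + 1) ≠ 0 := fun k =>
    sub_ne_zero.2 (pow_ne_one_of_norm_lt_one hq (by omega)).symm
  induction m with
  | zero =>
    simp only [S.ncard_sizeClass_zero, Nat.cast_one, one_mul]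
    simpa [qPoch_succ, qPoch_zero] using hasSum_geometric_of_norm_lt_one hq
  | succ m ih =>
    have hs : Summable fun n => ((sizeClass P size (m + 1) n).ncard : ℂ) * q ^ n := by
      refine Summable.of_norm ?_
      simpa using S.summable_ncard (norm_nonneg q) hq (m + 1)
    have h1 := hs.hasSum
    have h2 := (hasSum_shift (e (m + 1)) ih).add (hasSum_shift (2 * m + 3) h1)
    have h3 := h1.unique (h2.congr_fun fun n => by
      rw [S.ncard_sizeClass_succ]
      push_cast
      ring)
    have h4 : ∑' n, ((sizeClass P size (m + 1) n).ncard : ℂ) * q ^ n =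
        q ^ (∑ i ∈ Finset.range (m + 1), e (i + 1)) / qPoch q (q ^ 2) (m + 1 + 1) := by
      rw [qPoch_succ q _ (m + 1), Finset.sum_range_succ, pow_add]
      have e1 : q * (q ^ 2) ^ (m + 1) = q ^ (2 * m + 2 + 1) := by ring
      rw [e1]
      have h5 := hq1 (2 * m + 2)
      have h6 := qPoch_self_sq_ne_zero hq (m + 1)
      rw [eq_div_iff (mul_ne_zero h6 h5)]
      have h7 : qPoch q (q ^ 2) (m + 1) * (qPoch q (q ^ 2) (m + 1))⁻¹ = 1 := mul_inv_cancel₀ h6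
      rw [div_eq_mul_inv] at h3
      linear_combination qPoch q (q ^ 2) (m + 1) * h3 +
        q ^ e (m + 1) * q ^ (∑ i ∈ Finset.range m, e (i + 1)) * h7
    rw [← h4]
    exact h1

/-- The coefficients are nonnegative, so the norms of the terms are the terms at ‖z‖ and ‖q‖. The
first summability hypothesis therefore gives absolute convergence, after which the double series may
be summed row by row. -/
theorem hasSum_genTerm (S : StepSystem e P f size build start) {z q T : ℂ} (hq : ‖q‖ < 1)
    (hs : Summable fun m => (‖z‖ : ℂ) ^ m * ((‖q‖ : ℂ) ^ (∑ i ∈ Finset.range m, e (i + 1)) /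
      qPoch ‖q‖ ((‖q‖ : ℂ) ^ 2) (m + 1)))
    (hT : HasSum (fun m => z ^ m * (q ^ (∑ i ∈ Finset.range m, e (i + 1)) /
      qPoch q (q ^ 2) (m + 1))) T) : HasSum (genTerm (sizeClass P size) z q) T := by
  have hfib : ∀ (w p : ℂ), ‖p‖ < 1 → ∀ m, HasSum (fun n => genTerm (sizeClass P size) w p (m, n))
      (w ^ m * (p ^ (∑ i ∈ Finset.range m, e (i + 1)) / qPoch p (p ^ 2) (m + 1))) := by
    intro w p hp m
    refine ((S.hasSum_ncard hp m).mul_left (w ^ m)).congr_fun fun n => ?_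
    simp only [genTerm]
    ring
  have hnorm : ∀ p, ((‖genTerm (sizeClass P size) z q p‖ : ℝ) : ℂ) =
      genTerm (sizeClass P size) ‖z‖ ‖q‖ p := by
    intro p
    simp [genTerm]
  have hreal : ∀ m, HasSum (fun n => ((‖genTerm (sizeClass P size) z q (m, n)‖ : ℝ) : ℂ))
      ((‖z‖ : ℂ) ^ m * ((‖q‖ : ℂ) ^ (∑ i ∈ Finset.range m, e (i + 1)) /
        qPoch ‖q‖ ((‖q‖ : ℂ) ^ 2) (m + 1))) := by
    intro m
    simp only [hnorm]
    exact hfib _ _ (by simpa using hq) m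
  have hsum : Summable (genTerm (sizeClass P size) z q) := by
    refine Summable.of_norm ((summable_prod_of_nonneg fun _ => norm_nonneg _).2 ⟨fun m => ?_, ?_⟩)
    · exact Complex.summable_ofReal.1 (hreal m).summable
    · refine Complex.summable_ofReal.1 (hs.congr fun m => ?_)
      rw [Complex.ofReal_tsum]
      exact (hreal m).tsum_eq.symm
  have h1 := hsum.hasSum
  rwa [(h1.prod_fiberwise (hfib z q hq)).unique hT] at h1

end StepSystem

/-! ### The first family -/

/-- The generating function of the odd Ferrers graphs with `m + 1` rows. -/
noncomputable def omegaRowTerm (z q : ℂ) (m : ℕ) : ℂ :=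
  z ^ m * (q ^ m / qPoch q (q ^ 2) (m + 1))

theorem summable_omegaRowTerm {z q : ℂ} (hq : ‖q‖ < 1) (hz : ‖z * q‖ < 1) :
    Summable (omegaRowTerm z q) := by
  refine summable_of_ratio_tendsto (ρ := fun m => z * q / (1 - 1 * q ^ (2 * m + 3))) hz ?_ ?_
  · have h3 := tendsto_mul_pow_zero 1 hq (g := fun n => 2 * n + 3)
      (tendsto_atTop_mono (fun n => by dsimp; omega) tendsto_id)
    exact tendsto_div_of_tendsto_one tendsto_const_nhds (by simpa using h3.const_sub 1)
  · intro m
    unfold omegaRowTerm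
    rw [qPoch_succ q _ (m + 1), ← mul_div_assoc, ← mul_div_assoc, div_mul_div_comm]
    congr 1 <;> ring

/-- Replacing z by zq² multiplies the n-th term by q^(2n). So t_{n+1}(z) - q t_{n+1}(zq²) acquires
the factor 1 - q^(2n+3) and equals zq t_n(z). -/
theorem tsum_omegaRowTerm_functional {z q : ℂ} (hq : ‖q‖ < 1) (hz : ‖z * q‖ < 1) :
    (1 - z * q) * ∑' n, omegaRowTerm z q n = 1 + q * ∑' n, omegaRowTerm (z * q ^ 2) q n := by
  have hz' : ‖z * q ^ 2 * q‖ < 1 := by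
    rw [show z * q ^ 2 * q = z * q * q ^ 2 by ring, norm_mul]
    exact mul_lt_one_of_nonneg_of_lt_one_left (norm_nonneg _) hz (norm_sq_lt_one hq).le
  have hS := (summable_omegaRowTerm hq hz).hasSum
  have hS' := (summable_omegaRowTerm hq hz').hasSum
  have hq1 : ∀ k : ℕ, 1 - q ^ (k + 1) ≠ 0 := fun k =>
    sub_ne_zero.2 (pow_ne_one_of_norm_lt_one hq (by omega)).symm
  have h2 := (hasSum_nat_add_iff' 1).2 (hS.sub (hS'.mul_left q))
  have h4 := h2.unique ((hS.mul_left (z * q)).congr_fun fun n => by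
    unfold omegaRowTerm
    rw [qPoch_succ q _ (n + 1)]
    have e1 : q * (q ^ 2) ^ (n + 1) = q ^ (2 * n + 2 + 1) := by ring
    rw [e1]
    have := hq1 (2 * n + 2)
    have := qPoch_self_sq_ne_zero hq (n + 1)
    field_simp
    ring)
  have h5 : 1 - q ≠ 0 := by simpa using hq1 0
  have h6 : ∀ w, omegaRowTerm w q 0 = (1 - q)⁻¹ := fun w => by
    simp [omegaRowTerm, qPoch_succ, qPoch_zero]
  rw [Finset.sum_range_one, h6, h6] at h4
  have h7 : (1 - q) * (1 - q)⁻¹ = 1 := mul_inv_cancel₀ h5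
  linear_combination h4 + h7

theorem exists_norm_omegaRowTerm_le {q : ℂ} (hq : ‖q‖ < 1) :
    ∃ δ > 0, ∀ (z : ℂ) (n : ℕ), ‖z‖ < δ →
      ‖omegaRowTerm z q n‖ ≤ 1 / (1 - ‖q‖) * (1 / 2) ^ n := by
  have h01 : 0 < 1 - ‖q‖ := by linarith
  refine ⟨(1 - ‖q‖) / 2, by linarith, fun z n hz => ?_⟩
  have h2 := pow_le_norm_qPoch hq (n + 1)
  unfold omegaRowTerm
  rw [norm_mul, norm_div, norm_pow, norm_pow]
  calc _ ≤ ((1 - ‖q‖) / 2) ^ n * (1 / (1 - ‖q‖) ^ (n + 1)) := by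
        gcongr
        exact pow_le_one₀ (norm_nonneg _) hq.le
    _ = _ := by
        rw [div_pow, pow_succ, one_div_pow]
        field_simp

theorem mul_pow_ne_one {z q : ℂ} (hq : ‖q‖ < 1) (hz : ‖z * q‖ < 1) (k : ℕ) (hk : 1 ≤ k) :
    z * q ^ k ≠ 1 := by
  intro h
  have h1 := norm_mul_pow_le z hq hk
  rw [h, pow_one, norm_one] at h1
  linarith

theorem tsum_omegaRowTerm_eq {z q : ℂ} (hq : ‖q‖ < 1) (hz : ‖z * q‖ < 1) :
    ∑' n, omegaRowTerm z q n = ∑' n, omegaMockTerm z q n := by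
  have hz' := mul_pow_ne_one hq hz
  refine tsum_eq_of_functional (F := fun z => omegaRowTerm z q) (G := fun z => omegaMockTerm z q)
    hq hz' (summable_half _) (summable_half _) (fun k => tsum_omegaRowTerm_functional hq ?_)
    (fun k => tsum_omegaMockTerm_functional hq (orbit_ne_one hz' _))
    (exists_norm_omegaRowTerm_le hq) (exists_norm_omegaMockTerm_le hq)
  have h1 := norm_mul_pow_le z hq (show 1 ≤ 2 * k + 1 by omega)
  rw [pow_one] at h1
  rw [mul_assoc, ← pow_succ]
  exact h1.trans_lt hz

theorem hasSum_genTerm_BOmegaClass {z q : ℂ} (hq : ‖q‖ < 1) (hz : ‖z * q‖ < 1) :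
    HasSum (genTerm BOmegaClass z q) (∑' n, omegaMockTerm z q n) := by
  rw [← tsum_omegaRowTerm_eq hq hz]
  refine stepSystem_BOmega.hasSum_genTerm hq ?_ ?_
  · refine (summable_omegaRowTerm (z := ‖z‖) (q := ‖q‖) (by simpa using hq)
      (by simpa using hz)).congr fun m => ?_
    simp [omegaRowTerm]
  · refine (summable_omegaRowTerm hq hz).hasSum.congr_fun fun m => ?_
    simp [omegaRowTerm]

/-! ### The second family -/

theorem sum_range_two_mul_succ (m : ℕ) : ∑ i ∈ Finset.range m, 2 * (i + 1) = m ^ 2 + m := by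
  induction m with
  | zero => rfl
  | succ m ih => rw [Finset.sum_range_succ, ih]; ring

theorem hasSum_genTerm_BNuClass (z : ℂ) {q : ℂ} (hq : ‖q‖ < 1) :
    HasSum (genTerm BNuClass z q) (∑' n, nuMockTerm z q n) := by
  refine stepSystem_BNu.hasSum_genTerm hq ?_ ?_
  · refine (summable_nuMockTerm ‖z‖ (q := ‖q‖) (by simpa using hq)).congr fun m => ?_
    rw [nuMockTerm, sum_range_two_mul_succ, mul_div_assoc]
  · refine (summable_nuMockTerm z hq).hasSum.congr_fun fun m => ?_
    rw [nuMockTerm, sum_range_two_mul_succ, mul_div_assoc]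

/-- This carries the generating function of the graphs over to the partitions. -/
theorem genTerm_congr {C C' : ℕ → ℕ → Set (List ℕ)} {F : List ℕ → List ℕ}
    (h : ∀ m n, Set.BijOn F (C m n) (C' m n)) (z q : ℂ) : genTerm C z q = genTerm C' z q := by
  funext p
  unfold genTerm
  rw [← (h p.1 p.2).image_eq, (h p.1 p.2).injOn.ncard_image]

/-! ### The bijections -/

/-- The explicit map is definitionally the abstract `transform`, started at the row of n + 1 boxes.
-/
theorem bijOn_omegaToGraph (m n : ℕ) :
    Set.BijOn omegaToGraph (POmegaClass m n) (BOmegaClass m n) :=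
  stepSystem_POmega.bijOn_transform stepSystem_BOmega (fun _ _ => le_rfl) m n

theorem bijOn_graphToOmega (m n : ℕ) :
    Set.BijOn graphToOmega (BOmegaClass m n) (POmegaClass m n) :=
  stepSystem_BOmega.bijOn_transform stepSystem_POmega (fun _ _ => le_rfl) m n

theorem invOn_omegaToGraph (m n : ℕ) :
    Set.InvOn graphToOmega omegaToGraph (POmegaClass m n) (BOmegaClass m n) :=
  stepSystem_POmega.invOn_transform stepSystem_BOmega (fun _ _ => le_rfl) m n

theorem one_le_two_mul (k : ℕ) (hk : 1 ≤ k) : 1 ≤ 2 * k := by omega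

theorem bijOn_nuToGraph (m n : ℕ) : Set.BijOn nuToGraph (PNuClass m n) (BNuClass m n) :=
  stepSystem_PNu.bijOn_transform stepSystem_BNu one_le_two_mul m n

theorem bijOn_graphToNu (m n : ℕ) : Set.BijOn graphToNu (BNuClass m n) (PNuClass m n) :=
  stepSystem_BNu.bijOn_transform stepSystem_PNu one_le_two_mul m n

theorem invOn_nuToGraph (m n : ℕ) :
    Set.InvOn graphToNu nuToGraph (PNuClass m n) (BNuClass m n) :=
  stepSystem_PNu.invOn_transform stepSystem_BNu one_le_two_mul m n

end AndrewsYee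

theorem theorem1p1 :
    -- the first identity, in its original and in its shifted form
    (∀ z q : ℂ, ‖q‖ < 1 → (∀ k : ℕ, 1 ≤ k → z * q ^ k ≠ 1) →
      (∃ S : ℂ, HasSum (fun n : ℕ => AndrewsYee.omegaOriginalTerm z q (n + 1)) S ∧
        HasSum (AndrewsYee.omegaOriginalMockTerm z q) S) ∧
      (∃ S : ℂ, HasSum (AndrewsYee.omegaTerm z q) S ∧
        HasSum (AndrewsYee.omegaMockTerm z q) S)) ∧
    -- the second identity
    (∀ z q : ℂ, ‖q‖ < 1 →
      ∃ S : ℂ, HasSum (AndrewsYee.nuTerm z q) S ∧ HasSum (AndrewsYee.nuMockTerm z q) S) ∧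
    -- all classes are finite
    (∀ m n : ℕ, (AndrewsYee.POmegaClass m n).Finite ∧ (AndrewsYee.BOmegaClass m n).Finite ∧
      (AndrewsYee.PNuClass m n).Finite ∧ (AndrewsYee.BNuClass m n).Finite) ∧
    -- the two sides of the first identity are the generating functions of the two classes
    (∀ z q : ℂ, ‖q‖ < 1 → ‖z * q‖ < 1 →
      HasSum (AndrewsYee.genTerm AndrewsYee.POmegaClass z q)
        (∑' n : ℕ, AndrewsYee.omegaTerm z q n) ∧
      HasSum (AndrewsYee.genTerm AndrewsYee.BOmegaClass z q)
        (∑' n : ℕ, AndrewsYee.omegaMockTerm z q n)) ∧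
    -- the two sides of the second identity are the generating functions of the two classes
    (∀ z q : ℂ, ‖q‖ < 1 →
      HasSum (AndrewsYee.genTerm AndrewsYee.PNuClass z q)
        (∑' n : ℕ, AndrewsYee.nuTerm z q n) ∧
      HasSum (AndrewsYee.genTerm AndrewsYee.BNuClass z q)
        (∑' n : ℕ, AndrewsYee.nuMockTerm z q n)) ∧
    -- all four procedures stop
    ((∀ l ∈ AndrewsYee.POmega, ∃ i : ℕ, (AndrewsYee.psiMinus^[i] l).length = 1) ∧
      (∀ l ∈ AndrewsYee.BOmega, ∃ i : ℕ, (AndrewsYee.shrinkOmega^[i] l).length = 1) ∧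
      (∀ l ∈ AndrewsYee.PNu, ∃ i : ℕ, (AndrewsYee.rhoMinus^[i] l).length = 1) ∧
      (∀ l ∈ AndrewsYee.BNu, ∃ i : ℕ, (AndrewsYee.shrinkNu^[i] l).length = 1)) ∧
    -- the explicit bijections and their explicit inverses
    (∀ m n : ℕ,
      Set.BijOn AndrewsYee.omegaToGraph
        (AndrewsYee.POmegaClass m n) (AndrewsYee.BOmegaClass m n) ∧
      Set.BijOn AndrewsYee.graphToOmega
        (AndrewsYee.BOmegaClass m n) (AndrewsYee.POmegaClass m n) ∧
      Set.InvOn AndrewsYee.graphToOmega AndrewsYee.omegaToGraph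
        (AndrewsYee.POmegaClass m n) (AndrewsYee.BOmegaClass m n)) ∧
    (∀ m n : ℕ,
      Set.BijOn AndrewsYee.nuToGraph
        (AndrewsYee.PNuClass m n) (AndrewsYee.BNuClass m n) ∧
      Set.BijOn AndrewsYee.graphToNu
        (AndrewsYee.BNuClass m n) (AndrewsYee.PNuClass m n) ∧
      Set.InvOn AndrewsYee.graphToNu AndrewsYee.nuToGraph
        (AndrewsYee.PNuClass m n) (AndrewsYee.BNuClass m n)) := by 
  refine ⟨fun z q hq hz => ?_, fun z q hq => ?_, fun m n => ?_, fun z q hq hz => ?_,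
    fun z q hq => ?_, ?_, fun m n => ?_, fun m n => ?_⟩
  · have h1 := (AndrewsYee.summable_omegaTerm z hq).hasSum
    have h2 := (AndrewsYee.summable_omegaMockTerm z hq).hasSum
    rw [← AndrewsYee.tsum_omegaTerm_eq hq hz] at h2
    -- Both original series are q times the shifted ones; on the left the index moves by one.
    refine ⟨⟨_, (h1.mul_left q).congr_fun fun n => ?_, (h2.mul_left q).congr_fun fun n => ?_⟩,
      _, h1, h2⟩
    · exact AndrewsYee.omegaOriginalTerm_succ z q n
    · exact AndrewsYee.omegaOriginalMockTerm_eq z q n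
  · refine ⟨_, (AndrewsYee.summable_nuTerm z hq).hasSum, ?_⟩
    rw [AndrewsYee.tsum_nuTerm_eq z hq]
    exact (AndrewsYee.summable_nuMockTerm z hq).hasSum
  · exact ⟨AndrewsYee.stepSystem_POmega.finite_sizeClass m n,
      AndrewsYee.stepSystem_BOmega.finite_sizeClass m n,
      AndrewsYee.stepSystem_PNu.finite_sizeClass m n,
      AndrewsYee.stepSystem_BNu.finite_sizeClass m n⟩
  · have h := AndrewsYee.hasSum_genTerm_BOmegaClass hq hz
    rw [AndrewsYee.tsum_omegaTerm_eq hq (AndrewsYee.mul_pow_ne_one hq hz),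
      AndrewsYee.genTerm_congr AndrewsYee.bijOn_omegaToGraph]
    exact ⟨h, h⟩
  · have h := AndrewsYee.hasSum_genTerm_BNuClass z hq
    rw [AndrewsYee.tsum_nuTerm_eq z hq, AndrewsYee.genTerm_congr AndrewsYee.bijOn_nuToGraph]
    exact ⟨h, h⟩
  · exact ⟨AndrewsYee.stepSystem_POmega.exists_length_eq_one fun _ _ => le_rfl,
      AndrewsYee.stepSystem_BOmega.exists_length_eq_one fun _ _ => le_rfl,
      AndrewsYee.stepSystem_PNu.exists_length_eq_one AndrewsYee.one_le_two_mul,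
      AndrewsYee.stepSystem_BNu.exists_length_eq_one AndrewsYee.one_le_two_mul⟩
  · exact ⟨AndrewsYee.bijOn_omegaToGraph m n, AndrewsYee.bijOn_graphToOmega m n,
      AndrewsYee.invOn_omegaToGraph m n⟩
  · exact ⟨AndrewsYee.bijOn_nuToGraph m n, AndrewsYee.bijOn_graphToNu m n,
      AndrewsYee.invOn_nuToGraph m n⟩
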